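/- Let $G$ be a (finite-dimensional real, Hausdorff, smooth) Lie group with Lie algebra $\mathfrak g=T_eG$, and for $v\in\mathfrak g$ let $v^L_a=(dL_a)_e v$ be the associated left-invariant vector field; the bracket is $[v,w]=[v^L,w^L]_e$. For a diffeomorphism $\Phi$ of a manifold $M$, its lift to $T^*M$ is $\hat\Phi(p)=(\Phi^{-1})^*p\in T^*_{\Phi(q)}M$ for $p\in T_q^*M$; if $X$ is a smooth vector field on $M$ with flow $\phi_X^t$, its cotangent lift $\hat X$ is the vector field on $T^*M$ given by $\hat X_p=\frac{d}{dt}\big|_{t=0}\widehat{\phi_X^t}(p)$. **(1)** The map $\Theta:G\times\mathfrak g^*\to T^*G$, $(a,\psi)\mapsto L_{a^{-1}}^*\psi = \psi\circ (dL_{a^{-1}})_a\in T_a^*G$, is a diffeomorphism. For every $v\in\mathfrak g$, the field $v^L$ is complete with flow $\phi^t_{v^L}=R_{\exp(tv)}:a\mapsto a\exp(tv)$, and under the identification $\Theta$ (and $T_\psi\mathfrak g^*=\mathfrak g^*$): - the cotangent lift of $v^L$ is $\widehat{v^L}=(v^L,\mathrm{ad}^*_v)$, i.e. at $(a,\psi)$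 it equals $(v^L_a,\ \psi\circ \mathrm{ad}_v)$, where $\mathrm{ad}_v w=[v,w]$; - the lift of the flow is $\widehat{\phi^t_{v^L}}(a,\psi)=(a\exp(tv),\ \mathrm{Ad}^*_{\exp(tv)}\psi)$, where $\mathrm{Ad}^*_g\psi=\psi\circ\mathrm{Ad}_g$ and $\mathrm{Ad}_g=d(x\mapsto gxg^{-1})_e$; and these maps form the smooth global flow of $\widehat{v^L}$. **(2)** Let $v_1,\dots,v_n$ be a basis of $\mathfrak g$ with dual basis $\eta_1,\dots,\eta_n$ and structure constants $c_{ij}^k$, $[v_i,v_j]=\sum_k c_{ij}^k v_k$. Then $(a,\beta)\mapsto L_{a^{-1}}^*\big(\sum_k\beta_k\eta_k\big)$ is a diffeomorphism $G\times\mathbb R^n\to T^*G$. Let $f_1,\dots,f_n\in C^\infty(G)$ and let $V=\sum_i f_i v_i^L$ have smooth flow $\phi$ on some flow domain (for instance, $V$ complete and $\phi$ its global flow). Under this identification the cotangent lift of $V$ is $$\hat V_{(a,\beta)}=\Big(\sum_{i} f_i(a)\,(v_i^L)_a\,,\ \Big(\sum_{i,k} f_i(a)\,c_{ij}^k\,\beta_k-\sum_{i}\,v_j^L(f_i)(a)\,\beta_i\Big)_{j=1}^n\Big).$$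 If $V$ is complete, then for all $a\in G$ and $\beta^0\in\mathbb R^n$ the lifted flow has the form $\widehat{\phi^t}(a,\beta^0)=(\phi^t(a),\beta(t))$, where $\beta(0)=\beta^0$ and $\beta$ solves the adjoint equation $$\dot\beta_j(t)=\sum_{i,k} f_i(\phi^t(a))\,c_{ij}^k\,\beta_k(t)-\sum_i v_j^L(f_i)(\phi^t(a))\,\beta_i(t),\qquad j=1,\dots,n.$$ -/

import Mathlib

open Bundle Set Function
open scoped Manifold ContDiff Topology

noncomputable section

/-- The cotangent bundle `T*M`, with the topology and the smooth structure of Mathlib's bundle of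
continuous linear maps from `TM` to the trivial line bundle. Its model fibre is `E* = E →L[ℝ] ℝ`. -/
abbrev CotangentBundle {E H : Type*} [NormedAddCommGroup E] [NormedSpace ℝ E]
    [TopologicalSpace H] (I : ModelWithCorners ℝ E H)
    (M : Type*) [TopologicalSpace M] [ChartedSpace H M] : Type _ :=
  TotalSpace (E →L[ℝ] ℝ) (fun x : M => TangentSpace I x →L[ℝ] Trivial M ℝ x)

section Manifold

variable {E H M : Type*} [NormedAddCommGroup E] [NormedSpace ℝ E] [TopologicalSpace H]
  (I : ModelWithCorners ℝ E H) [TopologicalSpace M] [ChartedSpace H M]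

/-- `φ` is a (smooth) flow of the vector field `X`, with flow domain `D ⊆ ℝ × M`: `D` is open, each
slice `{t | (t, q) ∈ D}` is an interval containing `0`, `φ` is smooth on `D`, `φ 0 = id`, and
`t ↦ φ t q` is an integral curve of `X`. The flow is global when `D = univ`. -/
structure IsFlowOn (X : (q : M) → TangentSpace I q) (D : Set (ℝ × M)) (φ : ℝ → M → M) : Prop where
  isOpen : IsOpen D
  zero_mem : ∀ q, ((0 : ℝ), q) ∈ D
  ordConnected : ∀ q, OrdConnected {t : ℝ | (t, q) ∈ D}
  contMDiffOn : ContMDiffOn (𝓘(ℝ, ℝ).prod I) I ∞ (uncurry φ) D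
  map_zero : ∀ q, φ 0 q = q
  hasMFDerivAt : ∀ t q, (t, q) ∈ D →
    HasMFDerivAt 𝓘(ℝ, ℝ) I (fun s => φ s q) t ((1 : ℝ →L[ℝ] ℝ).smulRight (X (φ t q)))

/-- `φ` is a smooth global flow of `X` (in particular `X` is complete). -/
abbrev IsGlobalFlow (X : (q : M) → TangentSpace I q) (φ : ℝ → M → M) : Prop :=
  IsFlowOn I X univ φ

/-- The lift of a (local) diffeomorphism `Φ` to the cotangent bundle,
`p ∈ T*_q M ↦ p ∘ (dΦ_q)⁻¹ ∈ T*_{Φ q} M`, i.e. the pullback of `p` by `Φ⁻¹`. -/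
def cotangentMap (Φ : M → M) (p : CotangentBundle I M) : CotangentBundle I M :=
  ⟨Φ p.1, p.2.comp (mfderiv I I Φ p.1).inverse⟩

/-- For a diffeomorphism `Φ`, the lift is the pullback by `Φ⁻¹`. -/
theorem cotangentMap_diffeomorph (Φ : Diffeomorph I I M M ∞)
    (p : CotangentBundle I M) (w : TangentSpace I (Φ p.1)) :
    (cotangentMap I Φ p).2 w =
      p.2 ((mfderiv I I Φ.symm (Φ p.1) : TangentSpace I (Φ p.1) →L[ℝ] TangentSpace I p.1) w) := by
  have h1 : HasMFDerivAt I I Φ p.1 (mfderiv I I Φ p.1) :=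
    (Φ.mdifferentiable (by simp) p.1).hasMFDerivAt
  have h2 : HasMFDerivAt I I Φ.symm (Φ p.1) (mfderiv I I Φ.symm (Φ p.1)) :=
    (Φ.symm.mdifferentiable (by simp) (Φ p.1)).hasMFDerivAt
  have h3 : HasMFDerivAt I I Φ (Φ.symm (Φ p.1)) (mfderiv I I Φ p.1 : E →L[ℝ] E) := by
    rw [Φ.symm_apply_apply]; exact h1
  have e1 := hasMFDerivAt_unique ((h2.comp p.1 h1).congr_of_eventuallyEq
    (Filter.Eventually.of_forall fun x => (Φ.symm_apply_apply x).symm)) (hasMFDerivAt_id p.1)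
  have e2 := hasMFDerivAt_unique ((h3.comp (Φ p.1) h2).congr_of_eventuallyEq
    (Filter.Eventually.of_forall fun x => (Φ.apply_symm_apply x).symm)) (hasMFDerivAt_id (Φ p.1))
  have e : (mfderiv I I Φ p.1).inverse =
      (mfderiv I I Φ.symm (Φ p.1) : TangentSpace I (Φ p.1) →L[ℝ] TangentSpace I p.1) :=
    ContinuousLinearMap.inverse_eq e2 e1
  change p.2 ((mfderiv I I Φ p.1).inverse w) = _
  rw [e]; rfl

variable [IsManifold I 1 M]

/-- `Y` is the cotangent lift of the vector field `X`: with `φ` the flow of `X`, the value of `Y` at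
each covector `p` is the velocity at `t = 0` of the curve `t ↦ (lift of φ t) p` in `T*M`. (Flows of a
smooth field on a Hausdorff manifold agree on common domains, so the choice is immaterial.) -/
def IsCotangentLift (X : (q : M) → TangentSpace I q)
    (Y : (p : CotangentBundle I M) → TangentSpace (I.prod 𝓘(ℝ, E →L[ℝ] ℝ)) p) : Prop :=
  ∃ (D : Set (ℝ × M)) (φ : ℝ → M → M), IsFlowOn I X D φ ∧ ∀ p : CotangentBundle I M,
    HasMFDerivAt 𝓘(ℝ, ℝ) (I.prod 𝓘(ℝ, E →L[ℝ] ℝ)) (fun t => cotangentMap I (φ t) p) 0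
      ((1 : ℝ →L[ℝ] ℝ).smulRight (Y p))

end Manifold

section LieGroup

variable {E H G : Type*} [NormedAddCommGroup E] [NormedSpace ℝ E] [TopologicalSpace H]
  (I : ModelWithCorners ℝ E H) [TopologicalSpace G] [ChartedSpace H G] [Group G]

instance instLieGroupMinSmoothness [LieGroup I ∞ G] : LieGroup I (minSmoothness ℝ 3) G := by
  rw [minSmoothness_of_isRCLikeNormedField]; infer_instance

/-- `γ` is the one-parameter subgroup of `G` with initial velocity `v`. -/
structure IsOneParameterSubgroup (γ : ℝ → G) (v : GroupLieAlgebra I G) : Prop where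
  map_add : ∀ s t, γ (s + t) = γ s * γ t
  contMDiff : ContMDiff 𝓘(ℝ, ℝ) I ∞ γ
  hasMFDerivAt : HasMFDerivAt 𝓘(ℝ, ℝ) I γ 0 ((1 : ℝ →L[ℝ] ℝ).smulRight v)

/-- The exponential map: `exp v = γ 1`, where `γ` is the one-parameter subgroup with initial
velocity `v`. -/
def lieExp (v : GroupLieAlgebra I G) : G :=
  Classical.epsilon (fun γ : ℝ → G => IsOneParameterSubgroup I γ v) 1

/-- `Ad_g`, the differential at the identity of the conjugation `x ↦ g x g⁻¹`. -/
def lieAd (g : G) : GroupLieAlgebra I G →L[ℝ] GroupLieAlgebra I G :=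
  mfderiv I I (fun x : G => g * x * g⁻¹) 1

/-- `Ad*_g`, the transpose of `Ad_g`. The dual `𝔤*` of the Lie algebra is `E →L[ℝ] ℝ`, as the
tangent space `𝔤 = T_1 G` is by definition a copy of `E`. -/
def lieCoAd (g : G) (ψ : E →L[ℝ] ℝ) : E →L[ℝ] ℝ := ψ.comp (lieAd I g)

/-- `ad*_v`, the transpose of `ad_v : w ↦ [v, w]`. -/
def coad [FiniteDimensional ℝ E] [LieGroup I ∞ G] (v : GroupLieAlgebra I G) (ψ : E →L[ℝ] ℝ) :
    E →L[ℝ] ℝ :=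
  LinearMap.toContinuousLinearMap (E := E)
    ((ψ : E →ₗ[ℝ] ℝ) ∘ₗ (LieAlgebra.ad ℝ (GroupLieAlgebra I G) v : E →ₗ[ℝ] E))

/-- Left translation of covectors, `(a, ψ) ↦ (L_{a⁻¹})^* ψ ∈ T*_a G`. -/
def leftCovector (x : G × (E →L[ℝ] ℝ)) : CotangentBundle I G :=
  ⟨x.1, x.2.comp (mfderiv I I (fun y : G => x.1⁻¹ * y) x.1)⟩

/-- The vector field `(v^L, ad*_v)` on `G × 𝔤*`, where `v^L` is the left-invariant field of `v` and
`T_ψ 𝔤* = 𝔤*`. -/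
def leftCoadField [FiniteDimensional ℝ E] [LieGroup I ∞ G] (v : GroupLieAlgebra I G)
    (x : G × (E →L[ℝ] ℝ)) : TangentSpace (I.prod 𝓘(ℝ, E →L[ℝ] ℝ)) x :=
  (mulInvariantVectorField v x.1, coad I v x.2)

variable {ι : Type*} [Fintype ι]

/-- `∑ i, f i • v_i^L`, for `v` a basis of `𝔤` and functions `f i` on `G`. -/
def frameField (b : Module.Basis ι ℝ (GroupLieAlgebra I G)) (f : ι → G → ℝ) (a : G) :
    TangentSpace I a :=
  ∑ i, f i a • (mulInvariantVectorField (b i) a : TangentSpace I a)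

/-- The covector with coordinates `β` in the dual basis: `∑ k, β k • η_k ∈ 𝔤*`. -/
def dualCombination [FiniteDimensional ℝ E] (b : Module.Basis ι ℝ (GroupLieAlgebra I G))
    (β : ι → ℝ) : E →L[ℝ] ℝ :=
  LinearMap.toContinuousLinearMap (E := E)
    ((∑ k, β k • b.coord k : GroupLieAlgebra I G →ₗ[ℝ] ℝ) : E →ₗ[ℝ] ℝ)

/-- The structure constants: `[v_i, v_j] = ∑ k, c i j k • v_k`. -/
def structureConstant (b : Module.Basis ι ℝ (GroupLieAlgebra I G)) (i j k : ι) : ℝ :=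
  b.repr ⁅b i, b j⁆ k

/-- The derivative `X(f) = df(X)` of a function along a vector field. -/
def derivAlong (X : (a : G) → TangentSpace I a) (f : G → ℝ) (a : G) : ℝ :=
  mfderiv I 𝓘(ℝ, ℝ) f a (X a)

/-- The right-hand side of the adjoint equation: the `j`-th component is
`∑ i, ∑ k, f i * c i j k * β k - ∑ i, v_j^L (f i) * β i`. -/
def adjointRHS (b : Module.Basis ι ℝ (GroupLieAlgebra I G)) (f : ι → G → ℝ)
    (a : G) (β : ι → ℝ) (j : ι) : ℝ :=
  (∑ i, ∑ k, f i a * structureConstant I b i j k * β k) -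
    ∑ i, derivAlong I (mulInvariantVectorField (b j)) (f i) a * β i

/-- The vector field on `G × (ι → ℝ)` with components `∑ i, f i • v_i^L` and `adjointRHS`. -/
def adjointField (b : Module.Basis ι ℝ (GroupLieAlgebra I G)) (f : ι → G → ℝ)
    (x : G × (ι → ℝ)) : TangentSpace (I.prod 𝓘(ℝ, ι → ℝ)) x :=
  (frameField I b f x.1, adjointRHS I b f x.1 x.2)

end LieGroup

end

/-! ### Pullback by a flow and the Lie bracket, in a normed space -/

noncomputable section

/-! A covector at `a` is determined by its values on left-invariant fields. Recording these values
(`leftFunctional`) inverts `Θ`, and the question becomes how they vary along a lifted flow. If `p =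
Θ (a, ψ)` and `φ` is a flow of `X`, the lift of `p` under `φ t` takes on `w^L` the value `p
((dφ_t)⁻¹ w^L)`, with `w^L` taken at `φ t a`. Its derivative at `t = 0` is `p ([X, w^L])`, by
`IsFlowOn.hasDerivAt_inverse_mfderiv`; in a chart this is the symmetry of the mixed second
derivatives of the flow. For `X = v^L` the bracket is `[v, w]^L`, which gives `ad*_v`; for `X = ∑
f_i v_i^L` the Leibniz rule (`mlieBracket_frameField`) adds the terms `-v_j^L(f_i)`, which gives the
adjoint equation.

Uniqueness of integral curves makes a global flow, hence its lift, a one-parameter group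
(`IsGlobalFlow.cotangentMap_add`). The velocity at time `t` is therefore the initial velocity from
the point reached at time `t`, so the adjoint equation is read off the lifted flow instead of being
solved.

Left translations permute the integral curves of `v^L`. This gives completeness, the exponential,
and the flow by right translations. Finally `R_g ∘ L_a ∘ C_g = L_{ag}`, with `C_g` conjugation,
turns the lift of `R_g` into `Ad*_g`. -/

theorem HasDerivAt.ringInverse_of_eq_one {R : Type*} [NormedRing R] [NormedAlgebra ℝ R]
    [HasSummableGeomSeries R] {A : ℝ → R} {A' : R} {t : ℝ} (hA : HasDerivAt A A' t)
    (h : A t = 1) : HasDerivAt (fun s => Ring.inverse (A s)) (-A') t := by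
  have h1 := hasFDerivAt_ringInverse (𝕜 := ℝ) (1 : Rˣ)
  have h2 : ((1 : Rˣ) : R) = A t := by rw [h, Units.val_one]
  rw [h2] at h1
  refine (h1.comp_hasDerivAt t hA).congr_deriv ?_
  rw [neg_apply, ContinuousLinearMap.mulLeftRight_apply, inv_one,
    Units.val_one, one_mul, mul_one]

theorem HasDerivAt.clm_inverse_of_eq_id {E : Type*} [NormedAddCommGroup E] [NormedSpace ℝ E]
    [CompleteSpace E] {A : ℝ → E →L[ℝ] E} {A' : E →L[ℝ] E} {t : ℝ} (hA : HasDerivAt A A' t)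
    (h : A t = ContinuousLinearMap.id ℝ E) : HasDerivAt (fun s => (A s).inverse) (-A') t := by
  simpa only [ContinuousLinearMap.ringInverse_eq_inverse] using hA.ringInverse_of_eq_one h

/-- The derivative at time zero of the pullback of a vector field by a flow is the Lie bracket. -/
theorem hasDerivAt_inverse_fderiv_flow {E : Type*} [NormedAddCommGroup E] [NormedSpace ℝ E]
    [CompleteSpace E] {F : ℝ × E → E} {x : E} (hF : ContDiffAt ℝ 2 F (0, x))
    (hF0 : ∀ᶠ y in 𝓝 x, F (0, y) = y) {V W : E → E}
    (hV : ∀ᶠ y in 𝓝 x, fderiv ℝ F (0, y) (1, 0) = V y) (hW : DifferentiableAt ℝ W x) :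
    HasDerivAt (fun t => (fderiv ℝ (fun y => F (t, y)) x).inverse (W (F (t, x))))
      (VectorField.lieBracket ℝ V W x) 0 := by
  have hx : F (0, x) = x := hF0.self_of_nhds
  have hdiff : ∀ᶠ z in 𝓝 ((0 : ℝ), x), DifferentiableAt ℝ F z := by
    filter_upwards [hF.eventually (by simp)] with z hz using hz.differentiableAt (by simp)
  have ht : Filter.Tendsto (fun t : ℝ => (t, x)) (𝓝 0) (𝓝 (0, x)) :=
    (Continuous.prodMk_left x).tendsto 0
  have hpart : ∀ᶠ t in 𝓝 (0 : ℝ), fderiv ℝ (fun y => F (t, y)) x =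
      (fderiv ℝ F (t, x)).comp (ContinuousLinearMap.inr ℝ ℝ E) := by
    filter_upwards [ht.eventually hdiff] with t h
    exact (h.hasFDerivAt.comp x (hasFDerivAt_prodMk_right t x)).fderiv
  have hD : DifferentiableAt ℝ (fderiv ℝ F) (0, x) :=
    (hF.fderiv_right (m := 1) (by norm_num)).differentiableAt (by simp)
  set S := fderiv ℝ (fderiv ℝ F) (0, x) with hS
  -- The derivative of `V` and the time derivative of the spatial differential are the two orders of
  -- the mixed second derivative of `F`; symmetry identifies them.
  have hsymm : ∀ v w, S v w = S w v := hF.isSymmSndFDerivAt (by simp)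
  have hc : HasDerivAt (fun t : ℝ => (t, x)) ((1 : ℝ), (0 : E)) 0 :=
    (hasDerivAt_id 0).prodMk (hasDerivAt_const 0 x)
  have hDt : HasDerivAt (fun t => (fderiv ℝ F (t, x)).comp (ContinuousLinearMap.inr ℝ ℝ E))
      ((S (1, 0)).comp (ContinuousLinearMap.inr ℝ ℝ E)) 0 := by
    have h1 : HasDerivAt (fun t => fderiv ℝ F (t, x)) (S (1, 0)) 0 :=
      hD.hasFDerivAt.comp_hasDerivAt (0 : ℝ) hc
    exact h1.clm_comp (hasDerivAt_const 0 _) |>.congr_deriv (by simp)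
  have h0 : (fderiv ℝ F (0, x)).comp (ContinuousLinearMap.inr ℝ ℝ E) =
      ContinuousLinearMap.id ℝ E := by
    rw [← hpart.self_of_nhds]
    exact (Filter.EventuallyEq.fderiv_eq hF0).trans fderiv_id
  have hVd : fderiv ℝ V x = (S.flip (1, 0)).comp (ContinuousLinearMap.inr ℝ ℝ E) := by
    have h1 : HasFDerivAt (fun y => fderiv ℝ F (0, y))
        (S.comp (ContinuousLinearMap.inr ℝ ℝ E)) x :=
      hD.hasFDerivAt.comp x (hasFDerivAt_prodMk_right (0 : ℝ) x)
    have h2 := h1.clm_apply (hasFDerivAt_const ((1 : ℝ), (0 : E)) x)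
    have h3 := (h2.congr_of_eventuallyEq (hV.mono fun y hy => hy.symm)).fderiv
    rw [h3]
    ext w
    simp
  have hinv : HasDerivAt (fun t => ((fderiv ℝ F (t, x)).comp
      (ContinuousLinearMap.inr ℝ ℝ E)).inverse)
      (-(S (1, 0)).comp (ContinuousLinearMap.inr ℝ ℝ E)) 0 :=
    hDt.clm_inverse_of_eq_id h0
  have hWF : HasDerivAt (fun t => W (F (t, x))) (fderiv ℝ W x (V x)) 0 := by
    have h1 : HasDerivAt (fun t => F (t, x)) (V x) 0 := by
      rw [← hV.self_of_nhds]
      exact (hdiff.self_of_nhds.hasFDerivAt).comp_hasDerivAt (0 : ℝ) hc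
    have h2 : HasFDerivAt W (fderiv ℝ W x) (F (0, x)) := by rw [hx]; exact hW.hasFDerivAt
    exact h2.comp_hasDerivAt (0 : ℝ) h1
  have key := hinv.clm_apply hWF
  refine (key.congr_of_eventuallyEq ?_).congr_deriv ?_
  · filter_upwards [hpart] with t h
    rw [h]
  · rw [h0, hx, VectorField.lieBracket_eq]
    simp [hVd, hsymm (1, 0), neg_add_eq_sub]

end

/-! ### Pullback by a flow and the Lie bracket, on a manifold -/

noncomputable section

/-- Change of frame at the endpoint: `A` is the differential of the chart there, and the identity
factor is that of the inverse chart at the centre. No invertibility of `B` is needed, since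
otherwise both inverses are zero by convention. -/
theorem ContinuousLinearMap.IsInvertible.inverse_apply_eq_inverse_comp_id_apply {E : Type*}
    [NormedAddCommGroup E] [NormedSpace ℝ E] {A : E →L[ℝ] E} (hA : A.IsInvertible)
    (B : E →L[ℝ] E) (w : E) :
    B.inverse w = ((A.comp B).comp (ContinuousLinearMap.id ℝ E)).inverse (A w) := by
  rw [ContinuousLinearMap.comp_id, hA.inverse_comp_of_left, ContinuousLinearMap.comp_apply,
    hA.inverse_apply_self]

section
variable {E H M : Type*} [NormedAddCommGroup E] [NormedSpace ℝ E] [TopologicalSpace H]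
  {I : ModelWithCorners ℝ E H} [TopologicalSpace M] [ChartedSpace H M]

theorem IsFlowOn.contMDiffAt {X : (q : M) → TangentSpace I q} {D : Set (ℝ × M)} {φ : ℝ → M → M}
    (h : IsFlowOn I X D φ) {t : ℝ} {q : M} (hq : (t, q) ∈ D) :
    ContMDiffAt (𝓘(ℝ, ℝ).prod I) I ∞ (uncurry φ) (t, q) :=
  h.contMDiffOn.contMDiffAt (h.isOpen.mem_nhds hq)

theorem IsFlowOn.mdifferentiableAt {X : (q : M) → TangentSpace I q} {D : Set (ℝ × M)}
    {φ : ℝ → M → M} (h : IsFlowOn I X D φ) {t : ℝ} {q : M} (hq : (t, q) ∈ D) :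
    MDifferentiableAt I I (φ t) q := by
  have h1 := (h.contMDiffAt hq).mdifferentiableAt (by simp)
  exact h1.comp q (mdifferentiableAt_const.prodMk mdifferentiableAt_id)

/-- The pullback of a vector field by a flow, differentiated at time zero, gives the bracket. -/
theorem IsFlowOn.hasDerivAt_inverse_mfderiv [IsManifold I ∞ M] [IsManifold I 2 M]
    [IsManifold I 1 M] [I.Boundaryless]
    [CompleteSpace E] {X : (q : M) → TangentSpace I q} {D : Set (ℝ × M)} {φ : ℝ → M → M}
    (h : IsFlowOn I X D φ) {W : (q : M) → TangentSpace I q} {q : M}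
    (hW : MDifferentiableAt I I.tangent (fun x => (W x : TangentBundle I M)) q) :
    HasDerivAt (F := E) (fun t => (mfderiv I I (φ t) q).inverse (W (φ t q)))
      (VectorField.mlieBracket I X W q) 0 := by
  set e := extChartAt I q with he
  have hq : q ∈ e.source := mem_extChartAt_source q
  have htgt : e.target ∈ 𝓝 (e q) := extChartAt_target_mem_nhds q
  have hsrc : e.source ∈ 𝓝 q := extChartAt_source_mem_nhds q
  have hφc : ContinuousAt (fun t => φ t q) 0 := (h.hasMFDerivAt 0 q (h.zero_mem q)).1
  have hφs : ∀ᶠ t in 𝓝 (0 : ℝ), φ t q ∈ e.source :=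
    hφc.eventually (by simpa [h.map_zero] using hsrc)
  have hD : ∀ᶠ t in 𝓝 (0 : ℝ), (t, q) ∈ D :=
    (Continuous.prodMk_left q).continuousAt.eventually (h.isOpen.mem_nhds (h.zero_mem q))
  have hmd : ∀ y ∈ e.source, MDifferentiableAt I 𝓘(ℝ, E) e y := fun y hy =>
    mdifferentiableAt_extChartAt (by simpa [he] using hy)
  have hmds : ∀ y ∈ e.target, MDifferentiableAt 𝓘(ℝ, E) I e.symm y := fun y hy => by
    have := mdifferentiableWithinAt_extChartAt_symm (I := I) hy
    rwa [I.range_eq_univ, mdifferentiableWithinAt_univ] at this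
  -- The differentials are named as endomorphisms of `E`, so that composing them does not involve
  -- tangent spaces at different points.
  obtain ⟨de, hde⟩ : ∃ de : M → E →L[ℝ] E, de = fun y => mfderiv I 𝓘(ℝ, E) e y := ⟨_, rfl⟩
  obtain ⟨des, hdes⟩ : ∃ des : E → E →L[ℝ] E, des = fun y => mfderiv 𝓘(ℝ, E) I e.symm y :=
    ⟨_, rfl⟩
  obtain ⟨dφ, hdφ⟩ : ∃ dφ : ℝ → E →L[ℝ] E, dφ = fun t => mfderiv I I (φ t) q := ⟨_, rfl⟩
  have hcomp : ∀ y ∈ e.source, (des (e y)).comp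
      (de y) = ContinuousLinearMap.id ℝ E := fun y hy => by
    have := mfderivWithin_extChartAt_symm_comp_mfderiv_extChartAt' (I := I) hy
    rw [I.range_eq_univ, mfderivWithin_univ] at this
    subst hde hdes
    exact this
  have hcomp' : ∀ y ∈ e.source, (de y).comp
      (des (e y)) = ContinuousLinearMap.id ℝ E := fun y hy => by
    have := mfderiv_extChartAt_comp_mfderivWithin_extChartAt_symm' (I := I) hy
    rw [I.range_eq_univ, mfderivWithin_univ] at this
    subst hde hdes
    exact this
  -- `T_q M` is identified with `E` by the preferred chart at `q`, so this differential is the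
  -- identity.
  have hid : des (e q) = ContinuousLinearMap.id ℝ E := by
    have := mfderivWithin_range_extChartAt_symm (I := I) (x := q)
    rw [I.range_eq_univ, mfderivWithin_univ] at this
    subst hde hdes
    exact this
  have hpull : ∀ (Z : (q : M) → TangentSpace I q), ∀ y ∈ e.source,
      VectorField.mpullbackWithin 𝓘(ℝ, E) I e.symm Z (range I) (e y) =
        (de y) (Z y) := fun Z y hy => by
    rw [VectorField.mpullbackWithin_apply, I.range_eq_univ, mfderivWithin_univ, e.left_inv hy]
    subst hde hdes
    exact congrArg (fun A : E →L[ℝ] E => A (Z y))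
      (ContinuousLinearMap.inverse_eq (hcomp y hy) (hcomp' y hy))
  set F : ℝ × E → E := fun z => e (φ z.1 (e.symm z.2)) with hFdef
  have hF : ContDiffAt ℝ 2 F (0, e q) := by
    have h1 : ContMDiffAt (𝓘(ℝ, ℝ).prod 𝓘(ℝ, E)) I 2 (fun z : ℝ × E => e.symm z.2) (0, e q) := by
      have : ContMDiffAt 𝓘(ℝ, E) I 2 e.symm (e q) :=
        (contMDiffOn_extChartAt_symm q).contMDiffAt htgt
      exact ContMDiffAt.comp ((0 : ℝ), e q) (g := e.symm) (f := Prod.snd) this contMDiffAt_snd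
    have h2 : ContMDiffAt (𝓘(ℝ, ℝ).prod 𝓘(ℝ, E)) I 2
        (fun z : ℝ × E => uncurry φ (z.1, e.symm z.2)) (0, e q) := by
      refine ContMDiffAt.comp ((0 : ℝ), e q) (g := uncurry φ)
        (f := fun z : ℝ × E => (z.1, e.symm z.2)) ?_ (contMDiffAt_fst.prodMk h1)
      simp only [e.left_inv hq]
      exact (h.contMDiffAt (h.zero_mem q)).of_le (by norm_cast)
    have h3 : ContMDiffAt (𝓘(ℝ, ℝ).prod 𝓘(ℝ, E)) 𝓘(ℝ, E) 2 F (0, e q) := by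
      refine ContMDiffAt.comp ((0 : ℝ), e q) (g := e)
        (f := fun z : ℝ × E => uncurry φ (z.1, e.symm z.2)) ?_ h2
      simp only [uncurry, e.left_inv hq, h.map_zero]
      exact contMDiffAt_extChartAt
    rw [← modelWithCornersSelf_prod, chartedSpaceSelf_prod] at h3
    exact h3.contDiffAt
  have hF0 : ∀ᶠ y in 𝓝 (e q), F (0, y) = y := by
    filter_upwards [htgt] with y hy
    simp [hFdef, h.map_zero, e.right_inv hy]
  have hV : ∀ᶠ y in 𝓝 (e q), fderiv ℝ F (0, y) (1, 0) =
      VectorField.mpullbackWithin 𝓘(ℝ, E) I e.symm X (range I) y := by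
    have hd : ∀ᶠ y in 𝓝 (e q), DifferentiableAt ℝ F (0, y) := by
      have h1 := hF.eventually (by simp)
      have h2 : Filter.Tendsto (fun y : E => ((0 : ℝ), y)) (𝓝 (e q)) (𝓝 (0, e q)) :=
        (Continuous.prodMk_right (0 : ℝ)).tendsto _
      filter_upwards [h2.eventually h1] with y hy using hy.differentiableAt (by simp)
    filter_upwards [htgt, hd] with y hy hdy
    obtain ⟨p, hp, rfl⟩ : ∃ p ∈ e.source, e p = y := ⟨e.symm y, e.map_target hy, e.right_inv hy⟩
    rw [hpull X p hp]
    have h1 : HasDerivAt (fun t : ℝ => F (t, e p)) (fderiv ℝ F (0, e p) (1, 0)) 0 :=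
      hdy.hasFDerivAt.comp_hasDerivAt (f := fun t : ℝ => (t, e p)) (0 : ℝ)
        ((hasDerivAt_id (0 : ℝ)).prodMk (hasDerivAt_const (0 : ℝ) (e p)))
    have h2 := h.hasMFDerivAt 0 p (h.zero_mem p)
    have h3 : HasMFDerivAt I 𝓘(ℝ, E) e (φ 0 p) (de (φ 0 p)) :=
      hde ▸ (hmd _ (by rwa [h.map_zero])).hasMFDerivAt
    have h4 : HasFDerivAt (e ∘ fun s => φ s p) ((de (φ 0 p)).comp
        (ContinuousLinearMap.smulRight (M₂ := E) (1 : ℝ →L[ℝ] ℝ) (X (φ 0 p)))) (0 : ℝ) :=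
      (h3.comp (0 : ℝ) h2).hasFDerivAt
    have h5 : (fun t : ℝ => F (t, e p)) = e ∘ fun s => φ s p := by
      ext t; simp [hFdef, e.left_inv hp]
    rw [h5] at h1
    rw [h1.unique h4.hasDerivAt, h.map_zero]
    exact congrArg (de p) (one_smul ℝ (X p : E))
  have hWd : DifferentiableAt ℝ
      (VectorField.mpullbackWithin 𝓘(ℝ, E) I e.symm W (range I)) (e q) := by
    have h1 :=
      (hW.mdifferentiableWithinAt (s := univ)).differentiableWithinAt_mpullbackWithin_vectorField
    rw [I.range_eq_univ, preimage_univ, univ_inter] at h1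
    rw [I.range_eq_univ]
    exact differentiableWithinAt_univ.1 h1
  have key := hasDerivAt_inverse_fderiv_flow hF hF0 hV hWd
  suffices hs : HasDerivAt (fun t => (dφ t).inverse (W (φ t q) : E))
      (VectorField.mlieBracket I X W q : E) 0 by rwa [hdφ] at hs
  refine (key.congr_of_eventuallyEq ?_).congr_deriv ?_
  -- Only small `t` matter: the orbit of `q` must stay in the chart and in the flow domain.
  · filter_upwards [hφs, hD] with t hts htD
    have hFt : F (t, e q) = e (φ t q) := by simp [hFdef, e.left_inv hq]
    have h1 : HasMFDerivAt 𝓘(ℝ, E) I e.symm (e q) (des (e q)) :=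
      hdes ▸ (hmds _ (mem_of_mem_nhds htgt)).hasMFDerivAt
    have h2 : HasMFDerivAt I I (φ t) (e.symm (e q)) (dφ t) := by
      rw [e.left_inv hq, hdφ]; exact (h.mdifferentiableAt htD).hasMFDerivAt
    have h3 : HasMFDerivAt I 𝓘(ℝ, E) e (φ t (e.symm (e q)))
        (de (φ t q)) := by
      rw [e.left_inv hq, hde]; exact (hmd _ hts).hasMFDerivAt
    have h4 : HasFDerivAt (fun y => F (t, y))
        (((de (φ t q)).comp (dφ t)).comp
          (des (e q))) (e q) :=
      (HasMFDerivAt.comp (e q) (HasMFDerivAt.comp (e.symm (e q)) h3 h2) h1).hasFDerivAt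
    have hinv : (de (φ t q)).IsInvertible :=
      .of_inverse (hcomp' _ hts) (hcomp _ hts)
    rw [hFt, hpull W _ hts, h4.fderiv, hid]
    exact hinv.inverse_apply_eq_inverse_comp_id_apply _ _
  · subst hde hdes hdφ
    rw [← VectorField.mlieBracketWithin_univ, VectorField.mlieBracketWithin_apply,
      mfderiv_extChartAt_self, preimage_univ, univ_inter, I.range_eq_univ]
    refine Eq.trans ?_
      (DFunLike.congr_fun (ContinuousLinearMap.inverse_id (R := ℝ) (M := E)) _).symm
    exact congrFun VectorField.lieBracketWithin_univ.symm _

end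
end

/-! ### Left trivialization of the cotangent bundle -/

noncomputable section

section
variable {E : Type*} [NormedAddCommGroup E] [NormedSpace ℝ E] [FiniteDimensional ℝ E]
  {ι : Type*}

/-- A functional on a finite-dimensional space is determined by its values on a basis. -/
def Module.Basis.evalDual [Finite ι] (b : Module.Basis ι ℝ E) : (E →L[ℝ] ℝ) ≃L[ℝ] (ι → ℝ) :=
  ((LinearMap.toContinuousLinearMap (𝕜 := ℝ) (E := E) (F' := ℝ)).symm.trans
    (b.constr ℝ).symm).toContinuousLinearEquiv

variable {E' H' N : Type*} [NormedAddCommGroup E'] [NormedSpace ℝ E'] [TopologicalSpace H']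
  {J : ModelWithCorners ℝ E' H'} [TopologicalSpace N] [ChartedSpace H' N]

/-- Evaluation on a basis is a linear homeomorphism onto coordinate space, so smoothness can be
tested on finitely many vectors. -/
theorem contMDiff_dual_of_apply {n : WithTop ℕ∞} {f : N → E →L[ℝ] ℝ}
    (h : ∀ w, ContMDiff J 𝓘(ℝ, ℝ) n (fun x => f x w)) : ContMDiff J 𝓘(ℝ, E →L[ℝ] ℝ) n f := by
  let b := Module.finBasis ℝ E
  have h1 : ContMDiff J 𝓘(ℝ, _) n (fun x => b.evalDual (f x)) :=
    contMDiff_pi_space.2 fun i => h (b i)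
  have h2 := (b.evalDual.symm : _ →L[ℝ] (E →L[ℝ] ℝ)).contMDiff.comp h1
  simpa [Function.comp_def] using h2

end

section
variable {E H G : Type*} [NormedAddCommGroup E] [NormedSpace ℝ E] [TopologicalSpace H]
  {I : ModelWithCorners ℝ E H} [TopologicalSpace G] [ChartedSpace H G] [Group G] [LieGroup I ∞ G]

/-- The partial differential of multiplication at `(g, 1)` depends smoothly on `g`, and `v^L` is its
value on a constant vector. It lands over `g * 1`; `aux` moves it to `g`. -/
theorem contMDiff_infty_mulInvariantVectorField (v : GroupLieAlgebra I G) :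
    ContMDiff I I.tangent ∞ (fun g : G => (mulInvariantVectorField v g : TangentBundle I G)) := by
  have h : ContMDiff I I.tangent ∞ (fun g : G =>
      (⟨g * 1, mfderiv I I (fun x : G => g * x) 1 v⟩ : TangentBundle I G)) := by
    intro g₀
    have h1 : ContMDiffAt I 𝓘(ℝ, E →L[ℝ] E) ∞ (inTangentCoordinates I I (fun _ : G => (1 : G))
        (fun g : G => g * 1) (fun g => mfderiv I I (fun x : G => g * x) 1) g₀) g₀ :=
      ContMDiffAt.mfderiv (fun g x : G => g * x) (fun _ => 1) (contMDiff_mul I ∞).contMDiffAt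
        contMDiffAt_const le_rfl
    have h2 : ContMDiffAt I I.tangent ∞ (fun _ : G => (⟨1, v⟩ : TangentBundle I G)) g₀ :=
      contMDiffAt_const
    exact ContMDiffAt.clm_apply_of_inCoordinates (E₁ := (TangentSpace I : G → Type _))
      (E₂ := (TangentSpace I : G → Type _)) (b₁ := fun _ : G => (1 : G))
      (b₂ := fun g : G => g * 1) (ϕ := fun g => mfderiv I I (fun x : G => g * x) 1)
      (v := fun _ : G => v) h1 h2 contMDiff_mul_right.contMDiffAt
  have aux : ∀ x y : G, x = y → ∀ w : E, (⟨x, w⟩ : TangentBundle I G) = ⟨y, w⟩ := by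
    rintro x _ rfl w; rfl
  convert! h using 2 with g
  exact aux _ _ (mul_one g).symm _

/-- Coordinates at `1` in its own chart are trivial. The equations `hx`, `hy` allow base points that
equal `1` only after simplification, such as `a⁻¹ * a`. -/
theorem continuousLinearMapAt_trivializationAt_one {x y : G} (hx : x = 1) (hy : y = 1) (u : E) :
    ((trivializationAt E (TangentSpace I : G → Type _) x).continuousLinearMapAt ℝ y :
      TangentSpace I y →L[ℝ] E) u = u := by
  subst hx hy
  rw [TangentBundle.continuousLinearMapAt_trivializationAt (mem_chart_source H 1),
    mfderiv_extChartAt_self]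
  rfl

theorem contMDiff_leftCovector :
    ContMDiff (I.prod 𝓘(ℝ, E →L[ℝ] ℝ)) (I.prod 𝓘(ℝ, E →L[ℝ] ℝ)) ∞
      (leftCovector I : G × (E →L[ℝ] ℝ) → CotangentBundle I G) := by
  rintro ⟨a₀, ψ₀⟩
  rw [contMDiffAt_hom_bundle]
  refine ⟨contMDiffAt_fst, ?_⟩
  have h1 : ContMDiffAt I 𝓘(ℝ, E →L[ℝ] E) ∞ (inTangentCoordinates I I (fun a : G => a)
      (fun a : G => a⁻¹ * a) (fun a => mfderiv I I (fun y : G => a⁻¹ * y) a) a₀) a₀ :=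
    ContMDiffAt.mfderiv (fun a y : G => a⁻¹ * y) (fun a => a)
      (((contMDiff_inv I ∞).comp contMDiff_fst).mul contMDiff_snd).contMDiffAt
      contMDiffAt_id le_rfl
  have hf : ContMDiffAt (I.prod 𝓘(ℝ, E →L[ℝ] ℝ)) I ∞
      (Prod.fst : G × (E →L[ℝ] ℝ) → G) (a₀, ψ₀) := contMDiffAt_fst
  have h := ContMDiffAt.comp (a₀, ψ₀) h1 hf
  have hs : ContMDiffAt (I.prod 𝓘(ℝ, E →L[ℝ] ℝ)) 𝓘(ℝ, E →L[ℝ] ℝ) ∞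
      (Prod.snd : G × (E →L[ℝ] ℝ) → E →L[ℝ] ℝ) (a₀, ψ₀) := contMDiffAt_snd
  -- In coordinates the map is `ψ` composed with the differential of `L_{a⁻¹}` at `a`. The target
  -- trivialization contributes nothing because that differential lands at the identity.
  refine (hs.clm_comp h).congr_of_eventuallyEq (Filter.Eventually.of_forall fun x => ?_)
  ext w
  let u : E := (mfderiv I I (fun y : G => x.1⁻¹ * y) x.1 : TangentSpace I x.1 → E)
    ((trivializationAt E (TangentSpace I : G → Type _) a₀).symmL ℝ x.1 w)
  have h3 := congrArg x.2 (continuousLinearMapAt_trivializationAt_one (I := I)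
    (inv_mul_cancel a₀) (inv_mul_cancel x.1) u).symm
  refine Eq.trans ?_ h3
  exact DFunLike.congr_fun (Trivial.continuousLinearMapAt_trivialization ℝ G ℝ x.1) (x.2 u)

/-- Right-inverse of the left translation of covectors: the functional `w ↦ p (w^L)`. -/
def leftFunctional (p : CotangentBundle I G) : E →L[ℝ] ℝ :=
  ContinuousLinearMap.comp (M₁ := E) (M₂ := E) (M₃ := ℝ) p.2 (mfderiv I I (fun y : G => p.1 * y) 1)

theorem hasMFDerivAt_mul_left (g h : G) :
    HasMFDerivAt I I (fun y : G => g * y) h (mfderiv I I (fun y : G => g * y) h) :=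
  ((contMDiff_mul_left (I := I) (n := ∞)).mdifferentiable (by simp) h).hasMFDerivAt

/-- Together with the next lemma, this makes `w ↦ w^L_a` and the differential of `L_{a⁻¹}` mutually
inverse, whence `Θ` is bijective. -/
theorem mfderiv_inv_mul_mulInvariantVectorField (a : G) (w : GroupLieAlgebra I G) :
    (mfderiv I I (fun y : G => a⁻¹ * y) a : TangentSpace I a → E) (mulInvariantVectorField w a) =
      w := by
  have h1 : HasMFDerivAt I I (fun y : G => a⁻¹ * y) (a * 1)
      (mfderiv I I (fun y : G => a⁻¹ * y) a : TangentSpace I a →L[ℝ] _) := by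
    rw [mul_one]; exact hasMFDerivAt_mul_left _ _
  have h2 := h1.comp (1 : G) (hasMFDerivAt_mul_left a 1)
  have h3 : (fun y : G => a⁻¹ * y) ∘ (fun y : G => a * y) = id := by ext; simp
  rw [h3] at h2
  exact DFunLike.congr_fun (hasMFDerivAt_unique h2 (hasMFDerivAt_id 1)) w

theorem mulInvariantVectorField_mfderiv_inv_mul (a : G) (u : TangentSpace I a) :
    mulInvariantVectorField (I := I) (G := G)
      ((mfderiv I I (fun y : G => a⁻¹ * y) a : TangentSpace I a → E) u) a = u := by
  have h1 : HasMFDerivAt I I (fun y : G => a * y) (a⁻¹ * a)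
      (mfderiv I I (fun y : G => a * y) 1 : TangentSpace I (1 : G) →L[ℝ] _) := by
    rw [inv_mul_cancel]; exact hasMFDerivAt_mul_left _ _
  have h2 := h1.comp a (hasMFDerivAt_mul_left a⁻¹ a)
  have h3 : (fun y : G => a * y) ∘ (fun y : G => a⁻¹ * y) = id := by ext; simp
  rw [h3] at h2
  exact DFunLike.congr_fun (hasMFDerivAt_unique h2 (hasMFDerivAt_id a)) u

theorem leftFunctional_leftCovector (x : G × (E →L[ℝ] ℝ)) :
    leftFunctional (leftCovector I x) = x.2 := by
  ext w
  exact congrArg x.2 (mfderiv_inv_mul_mulInvariantVectorField x.1 w)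

theorem leftCovector_leftFunctional (p : CotangentBundle I G) :
    leftCovector I (p.1, leftFunctional p) = p := by
  obtain ⟨a, p⟩ := p
  refine congrArg (TotalSpace.mk a) ?_
  ext w
  exact congrArg p (mulInvariantVectorField_mfderiv_inv_mul a w)

/-- For fixed `w` this is the bundle pairing of `p` with the smooth field `w^L`. -/
theorem contMDiff_leftFunctional [FiniteDimensional ℝ E] :
    ContMDiff (I.prod 𝓘(ℝ, E →L[ℝ] ℝ)) 𝓘(ℝ, E →L[ℝ] ℝ) ∞
      (leftFunctional : CotangentBundle I G → E →L[ℝ] ℝ) := by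
  refine contMDiff_dual_of_apply fun w => ?_
  have h1 : ContMDiff (I.prod 𝓘(ℝ, E →L[ℝ] ℝ)) I.tangent ∞ (fun p : CotangentBundle I G =>
      (⟨p.1, mulInvariantVectorField (I := I) w p.1⟩ : TangentBundle I G)) :=
    (contMDiff_infty_mulInvariantVectorField w).comp (contMDiff_proj _)
  have h2 : ContMDiff (I.prod 𝓘(ℝ, E →L[ℝ] ℝ)) (I.prod 𝓘(ℝ, ℝ)) ∞ (fun p : CotangentBundle I G =>
      (⟨p.1, p.2 (mulInvariantVectorField (I := I) w p.1)⟩ : TotalSpace ℝ (Trivial G ℝ))) :=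
    ContMDiff.clm_bundle_apply (b := fun p : CotangentBundle I G => p.1)
      (ϕ := fun p => p.2) contMDiff_id h1
  intro p
  exact (contMDiffAt_totalSpace.1 (h2 p)).2

variable (I G) in
/-- The left trivialization of the cotangent bundle of a Lie group. -/
def leftTrivialization [FiniteDimensional ℝ E] :
    Diffeomorph (I.prod 𝓘(ℝ, E →L[ℝ] ℝ)) (I.prod 𝓘(ℝ, E →L[ℝ] ℝ))
      (G × (E →L[ℝ] ℝ)) (CotangentBundle I G) ∞ where
  toFun := leftCovector I
  invFun p := (p.1, leftFunctional p)
  left_inv x := Prod.ext rfl (leftFunctional_leftCovector x)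
  right_inv := leftCovector_leftFunctional
  contMDiff_toFun := contMDiff_leftCovector
  contMDiff_invFun := (contMDiff_proj _).prodMk contMDiff_leftFunctional

end
end

/-! ### Lifted flows: functoriality, group law, velocity -/

noncomputable section
variable {V W : Type*} [NormedAddCommGroup V] [NormedSpace ℝ V] [NormedAddCommGroup W]
  [NormedSpace ℝ W]

theorem ContinuousLinearMap.comp_one_smulRight (A : V →L[ℝ] W) (z : V) :
    A.comp ((1 : ℝ →L[ℝ] ℝ).smulRight z) = (1 : ℝ →L[ℝ] ℝ).smulRight (A z) := by
  ext; simp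

theorem ContinuousLinearMap.one_smulRight_injective :
    Injective fun z : V => (1 : ℝ →L[ℝ] ℝ).smulRight z := fun z w h => by
  simpa using DFunLike.congr_fun h (1 : ℝ)

end

section

section
variable {E H M : Type*} [NormedAddCommGroup E] [NormedSpace ℝ E] [TopologicalSpace H]
  {I : ModelWithCorners ℝ E H} [TopologicalSpace M] [ChartedSpace H M]

theorem cotangentMap_of_forall_eq {Φ : M → M} (h : ∀ q, Φ q = q) (p : CotangentBundle I M) :
    cotangentMap I Φ p = p := by
  obtain rfl : Φ = id := funext h
  obtain ⟨q, p⟩ := p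
  refine congrArg (TotalSpace.mk q) ?_
  have h1 : (mfderiv I I (@id M) q : E →L[ℝ] E).inverse = ContinuousLinearMap.id ℝ E := by
    rw [mfderiv_id]; exact ContinuousLinearMap.inverse_id
  exact congrArg (fun A : E →L[ℝ] E => ContinuousLinearMap.comp (M₂ := E) (M₃ := ℝ) p A) h1

/-- Chain rule, with inverses reversing composition. One invertible factor suffices because
`inverse` vanishes on non-invertible maps. -/
theorem cotangentMap_comp {Φ Φ' : M → M} (p : CotangentBundle I M)
    (h : MDifferentiableAt I I Φ p.1) (h' : MDifferentiableAt I I Φ' (Φ p.1))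
    (hinv : (mfderiv I I Φ p.1).IsInvertible) :
    cotangentMap I (Φ' ∘ Φ) p = cotangentMap I Φ' (cotangentMap I Φ p) := by
  obtain ⟨q, p⟩ := p
  refine congrArg (TotalSpace.mk (Φ' (Φ q))) ?_
  have h1 : (mfderiv I I (Φ' ∘ Φ) q).inverse =
      (mfderiv I I Φ q).inverse.comp (mfderiv I I Φ' (Φ q)).inverse := by
    rw [mfderiv_comp q h' h]; exact hinv.inverse_comp_of_right
  exact congrArg (fun A => ContinuousLinearMap.comp p A) h1

theorem IsGlobalFlow.mdifferentiableAt {X : (q : M) → TangentSpace I q}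
    {φ : ℝ → M → M} (h : IsGlobalFlow I X φ) (t : ℝ) (q : M) : MDifferentiableAt I I (φ t) q :=
  IsFlowOn.mdifferentiableAt h (mem_univ _)

theorem IsGlobalFlow.isMIntegralCurve {X : (q : M) → TangentSpace I q}
    {φ : ℝ → M → M} (h : IsGlobalFlow I X φ) (q : M) : IsMIntegralCurve (fun t => φ t q) X :=
  fun t => h.hasMFDerivAt t q (mem_univ _)

variable [IsManifold I 1 M] [T2Space M] [I.Boundaryless]

/-- As functions of `s`, both sides are integral curves of `X` through `φ t q`, and these are unique
on a Hausdorff manifold. -/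
theorem IsGlobalFlow.map_add {X : (q : M) → TangentSpace I q} {φ : ℝ → M → M}
    (h : IsGlobalFlow I X φ)
    (hX : ContMDiff I I.tangent 1 (fun x => (⟨x, X x⟩ : TangentBundle I M)))
    (s t : ℝ) (q : M) : φ (s + t) q = φ s (φ t q) := by
  have h1 := (IsGlobalFlow.isMIntegralCurve h q).comp_add t
  have h2 := isMIntegralCurve_Ioo_eq_of_contMDiff_boundaryless (t₀ := 0) hX h1
    (IsGlobalFlow.isMIntegralCurve h (φ t q)) (by simp [h.map_zero])
  exact congrFun h2 s

theorem IsGlobalFlow.isInvertible_mfderiv {X : (q : M) → TangentSpace I q} {φ : ℝ → M → M}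
    (h : IsGlobalFlow I X φ)
    (hX : ContMDiff I I.tangent 1 (fun x => (⟨x, X x⟩ : TangentBundle I M)))
    (t : ℝ) (q : M) : (mfderiv I I (φ t) q).IsInvertible := by
  have key : ∀ (s : ℝ) (q : M), HasMFDerivAt I I (φ (-s) ∘ φ s) q
      (ContinuousLinearMap.id ℝ (TangentSpace I q)) := fun s q => by
    have : φ (-s) ∘ φ s = id := by
      ext x; rw [comp_apply, ← IsGlobalFlow.map_add h hX, neg_add_cancel, h.map_zero, id]
    rw [this]; exact hasMFDerivAt_id q
  have hq : φ (-t) (φ t q) = q := by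
    rw [← IsGlobalFlow.map_add h hX, neg_add_cancel, h.map_zero]
  have hd := fun (s : ℝ) (q : M) => (IsGlobalFlow.mdifferentiableAt h s q).hasMFDerivAt
  have h1 := hasMFDerivAt_unique ((hd (-t) (φ t q)).comp q (hd t q)) (key t q)
  have h2 : HasMFDerivAt I I (φ t) (φ (-t) (φ t q))
      (mfderiv I I (φ t) q : TangentSpace I q →L[ℝ] _) := by rw [hq]; exact hd t q
  have h3 := key (-t) (φ t q)
  rw [neg_neg] at h3
  have h4 := hasMFDerivAt_unique (h2.comp (φ t q) (hd (-t) (φ t q))) h3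
  exact .of_inverse h4 h1

theorem IsGlobalFlow.cotangentMap_add {X : (q : M) → TangentSpace I q} {φ : ℝ → M → M}
    (h : IsGlobalFlow I X φ)
    (hX : ContMDiff I I.tangent 1 (fun x => (⟨x, X x⟩ : TangentBundle I M)))
    (s t : ℝ) (p : CotangentBundle I M) :
    cotangentMap I (φ (s + t)) p = cotangentMap I (φ s) (cotangentMap I (φ t) p) := by
  rw [← cotangentMap_comp p (IsGlobalFlow.mdifferentiableAt h t _)
    (IsGlobalFlow.mdifferentiableAt h s _) (IsGlobalFlow.isInvertible_mfderiv h hX t _)]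
  congr 1
  ext q
  exact IsGlobalFlow.map_add h hX s t q

omit [T2Space M] [I.Boundaryless]
variable {E' H' N : Type*} [NormedAddCommGroup E'] [NormedSpace ℝ E'] [TopologicalSpace H']
  {J : ModelWithCorners ℝ E' H'} [TopologicalSpace N] [ChartedSpace H' N]
  (Ψ : Diffeomorph J (I.prod 𝓘(ℝ, E →L[ℝ] ℝ)) N (CotangentBundle I M) ∞)

/-- If, read through the diffeomorphism `Ψ`, lifted flows of `X` have initial velocity `Z`, then the
cotangent lift of `X` is the field corresponding to `Z`. -/
theorem isCotangentLift_iff_mpullback_eq {X : (q : M) → TangentSpace I q}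
    {Z : (x : N) → TangentSpace J x}
    (hZ : ∀ D φ, IsFlowOn I X D φ → ∀ x, HasMFDerivAt 𝓘(ℝ, ℝ) J
      (fun t => Ψ.symm (cotangentMap I (φ t) (Ψ x))) 0 ((1 : ℝ →L[ℝ] ℝ).smulRight (Z x)))
    (hex : ∃ D φ, IsFlowOn I X D φ)
    (Y : (p : CotangentBundle I M) → TangentSpace (I.prod 𝓘(ℝ, E →L[ℝ] ℝ)) p) :
    IsCotangentLift I X Y ↔
      VectorField.mpullback J (I.prod 𝓘(ℝ, E →L[ℝ] ℝ)) Ψ Y = Z := by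
  have hΨ : ∀ x, (mfderiv J (I.prod 𝓘(ℝ, E →L[ℝ] ℝ)) Ψ x).IsInvertible := fun x =>
    ⟨Ψ.mfderivToContinuousLinearEquiv (by simp) x, rfl⟩
  have hd : ∀ D φ, IsFlowOn I X D φ → ∀ x, HasMFDerivAt 𝓘(ℝ, ℝ) (I.prod 𝓘(ℝ, E →L[ℝ] ℝ))
      (fun t => cotangentMap I (φ t) (Ψ x)) 0 ((1 : ℝ →L[ℝ] ℝ).smulRight
        (mfderiv J (I.prod 𝓘(ℝ, E →L[ℝ] ℝ)) Ψ x (Z x))) := fun D φ h x => by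
    have h1 : HasMFDerivAt J (I.prod 𝓘(ℝ, E →L[ℝ] ℝ)) Ψ
        (Ψ.symm (cotangentMap I (φ 0) (Ψ x)))
        (mfderiv J (I.prod 𝓘(ℝ, E →L[ℝ] ℝ)) Ψ x : TangentSpace J x →L[ℝ] _) := by
      rw [cotangentMap_of_forall_eq h.map_zero, Ψ.symm_apply_apply]
      exact (Ψ.mdifferentiable (by simp) x).hasMFDerivAt
    have h2 := h1.comp (0 : ℝ) (hZ D φ h x)
    have h3 : (Ψ ∘ fun t => Ψ.symm (cotangentMap I (φ t) (Ψ x))) =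
        fun t => cotangentMap I (φ t) (Ψ x) := by ext1 t; simp
    rw [h3] at h2
    exact h2.congr_mfderiv (ContinuousLinearMap.comp_one_smulRight (V := E')
      (W := E × (E →L[ℝ] ℝ)) _ _)
  constructor
  -- The flow witnessing the lift is arbitrary, but `hZ` covers every flow, so uniqueness of
  -- derivatives determines `Y`.
  · rintro ⟨D, φ, h, hY⟩
    ext x
    have h1 := hasMFDerivAt_unique (hY (Ψ x)) (hd D φ h x)
    have h2 : Y (Ψ x) = mfderiv J (I.prod 𝓘(ℝ, E →L[ℝ] ℝ)) Ψ x (Z x) :=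
      ContinuousLinearMap.one_smulRight_injective (V := E × (E →L[ℝ] ℝ)) h1
    rw [VectorField.mpullback_apply, h2, (hΨ x).inverse_apply_self]
  · rintro rfl
    obtain ⟨D, φ, h⟩ := hex
    refine ⟨D, φ, h, fun p => ?_⟩
    obtain ⟨x, rfl⟩ := Ψ.surjective p
    have := hd D φ h x
    rwa [VectorField.mpullback_apply, (hΨ x).self_apply_inverse] at this

/-- By the group law, the lift at time `s` is the lift at time `s - t` applied to the point reached
at time `t`, so the velocity at `0` gives the velocity everywhere. -/
theorem IsGlobalFlow.hasMFDerivAt_symm_cotangentMap [T2Space M] [I.Boundaryless]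
    {X : (q : M) → TangentSpace I q} {φ : ℝ → M → M} (h : IsGlobalFlow I X φ)
    (hX : ContMDiff I I.tangent 1 (fun x => (⟨x, X x⟩ : TangentBundle I M)))
    {Z : (x : N) → TangentSpace J x}
    (hZ : ∀ x, HasMFDerivAt 𝓘(ℝ, ℝ) J
      (fun t => Ψ.symm (cotangentMap I (φ t) (Ψ x))) 0 ((1 : ℝ →L[ℝ] ℝ).smulRight (Z x)))
    (t : ℝ) (x : N) : HasMFDerivAt 𝓘(ℝ, ℝ) J
      (fun t => Ψ.symm (cotangentMap I (φ t) (Ψ x))) t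
      ((1 : ℝ →L[ℝ] ℝ).smulRight (Z (Ψ.symm (cotangentMap I (φ t) (Ψ x))))) := by
  have h1 := hZ (Ψ.symm (cotangentMap I (φ t) (Ψ x)))
  have h2 : HasMFDerivAt 𝓘(ℝ, ℝ) 𝓘(ℝ, ℝ) (fun s : ℝ => s - t) t (ContinuousLinearMap.id ℝ ℝ) :=
    ((hasFDerivAt_id (𝕜 := ℝ) t).sub_const t).hasMFDerivAt
  have h3 : HasMFDerivAt 𝓘(ℝ, ℝ) J
      (fun s => Ψ.symm (cotangentMap I (φ s) (Ψ (Ψ.symm (cotangentMap I (φ t) (Ψ x)))))) (t - t)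
      ((1 : ℝ →L[ℝ] ℝ).smulRight (Z (Ψ.symm (cotangentMap I (φ t) (Ψ x))))) := by
    rw [sub_self]; exact h1
  have h4 := HasMFDerivAt.comp (f := fun s : ℝ => s - t) t h3 h2
  have h5 : (fun s => Ψ.symm (cotangentMap I (φ s) (Ψ (Ψ.symm (cotangentMap I (φ t) (Ψ x)))))) ∘
      (fun s => s - t) = fun s => Ψ.symm (cotangentMap I (φ s) (Ψ x)) := by
    ext1 s
    rw [comp_apply, Ψ.apply_symm_apply, ← IsGlobalFlow.cotangentMap_add h hX, sub_add_cancel]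
  rw [h5] at h4
  exact h4

end
end

/-! ### Velocity of a lift in the left trivialization; brackets of frame fields -/

noncomputable section

theorem hasDerivAt_dual_of_basis {E : Type*} [NormedAddCommGroup E] [NormedSpace ℝ E]
    [FiniteDimensional ℝ E] {ι : Type*} [Finite ι] (b : Module.Basis ι ℝ E) {f : ℝ → E →L[ℝ] ℝ}
    {χ : E →L[ℝ] ℝ} {t : ℝ} (h : ∀ i, HasDerivAt (fun s => f s (b i)) (χ (b i)) t) :
    HasDerivAt f χ t := by
  have := Fintype.ofFinite ι
  have h1 : HasDerivAt (fun s => b.evalDual (f s)) (b.evalDual χ) t := hasDerivAt_pi.2 h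
  have h2 := (b.evalDual.symm : _ →L[ℝ] (E →L[ℝ] ℝ)).hasFDerivAt.comp_hasDerivAt t h1
  simpa [Function.comp_def] using h2

section
variable {E H G : Type*} [NormedAddCommGroup E] [NormedSpace ℝ E] [FiniteDimensional ℝ E]
  [TopologicalSpace H]
  {I : ModelWithCorners ℝ E H} [TopologicalSpace G] [ChartedSpace H G] [Group G] [LieGroup I ∞ G]

theorem leftTrivialization_apply (x : G × (E →L[ℝ] ℝ)) :
    leftTrivialization G I x = leftCovector I x := rfl

theorem ContinuousLinearMap.one_smulRight_prodMk {V W : Type*} [NormedAddCommGroup V]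
    [NormedSpace ℝ V] [NormedAddCommGroup W] [NormedSpace ℝ W] (v : V) (w : W) :
    ((1 : ℝ →L[ℝ] ℝ).smulRight v).prod ((1 : ℝ →L[ℝ] ℝ).smulRight w) =
      (1 : ℝ →L[ℝ] ℝ).smulRight (v, w) := by
  ext <;> simp

omit [FiniteDimensional ℝ E] [Group G] [LieGroup I ∞ G] in
theorem IsFlowOn.hasMFDerivAt_prodMk {X : (a : G) → TangentSpace I a} {D : Set (ℝ × G)}
    {φ : ℝ → G → G} (h : IsFlowOn I X D φ) {V : Type*} [NormedAddCommGroup V] [NormedSpace ℝ V]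
    {g : ℝ → V} {g' : V} (hg : HasDerivAt g g' 0) (x : G × V) :
    HasMFDerivAt 𝓘(ℝ, ℝ) (I.prod 𝓘(ℝ, V)) (fun t => (φ t x.1, g t)) 0
      ((1 : ℝ →L[ℝ] ℝ).smulRight ((X x.1, g') : TangentSpace (I.prod 𝓘(ℝ, V)) x)) := by
  obtain ⟨a, v⟩ := x
  obtain ⟨ξ, hξ⟩ : ∃ ξ : E, ξ = X a := ⟨_, rfl⟩
  have h1 := h.hasMFDerivAt 0 a (h.zero_mem a)
  have h2 : HasMFDerivAt 𝓘(ℝ, ℝ) I (fun t => φ t a) 0 ((1 : ℝ →L[ℝ] ℝ).smulRight ξ) := by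
    rw [h.map_zero] at h1; rw [hξ]; exact h1
  have h6 := h2.prodMk hg.hasFDerivAt.hasMFDerivAt
  have h7 := h6.congr_mfderiv (ContinuousLinearMap.one_smulRight_prodMk (V := E) ξ g')
  subst hξ
  exact h7

/-- The initial velocity of a lifted flow in the left trivialization. -/
theorem IsFlowOn.hasDerivAt_leftFunctional [I.Boundaryless]
    {X : (a : G) → TangentSpace I a} {D : Set (ℝ × G)} {φ : ℝ → G → G} (h : IsFlowOn I X D φ)
    {ι : Type*} [Finite ι] (b : Module.Basis ι ℝ (GroupLieAlgebra I G)) (a : G) (ψ : E →L[ℝ] ℝ)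
    (χ : E →L[ℝ] ℝ)
    (hχ : ∀ i, χ (b i) = ψ ((mfderiv I I (fun y : G => a⁻¹ * y) a : TangentSpace I a → E)
      (VectorField.mlieBracket I X (mulInvariantVectorField (b i)) a))) :
    HasDerivAt (fun t => leftFunctional (cotangentMap I (φ t) (leftCovector I (a, ψ)))) χ 0 := by
  refine hasDerivAt_dual_of_basis (E := E) b fun i => ?_
  obtain ⟨A, hA⟩ : ∃ A : E →L[ℝ] E, A = mfderiv I I (fun y : G => a⁻¹ * y) a := ⟨_, rfl⟩
  have hW := (contMDiff_infty_mulInvariantVectorField (I := I) (G := G) (b i)).mdifferentiable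
    (by simp) a
  -- The value of the lifted covector on a left-invariant field is the fixed covector `ψ.comp A`
  -- applied to the pullback of that field by the flow.
  have h5 := (ψ.comp A).hasFDerivAt.comp_hasDerivAt (0 : ℝ) (h.hasDerivAt_inverse_mfderiv hW)
  subst hA
  exact h5.congr_deriv (hχ i).symm

omit [LieGroup I ∞ G] in
theorem dualCombination_apply {ι : Type*} [Fintype ι] (b : Module.Basis ι ℝ (GroupLieAlgebra I G))
    (β : ι → ℝ) (i : ι) : dualCombination I b β (b i) = β i := by
  classical
  change (∑ k, β k • b.coord k : GroupLieAlgebra I G →ₗ[ℝ] ℝ) (b i) = β i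
  simp [Finsupp.single_apply]

omit [LieGroup I ∞ G] in
theorem evalDual_symm_eq_dualCombination {ι : Type*} [Fintype ι]
    (b : Module.Basis ι ℝ (GroupLieAlgebra I G)) (β : ι → ℝ) :
    (Module.Basis.evalDual (E := E) b).symm β = dualCombination I b β := by
  rw [ContinuousLinearEquiv.symm_apply_eq]
  ext i
  exact (dualCombination_apply b β i).symm

theorem mlieBracket_mulInvariantVectorField (v w : GroupLieAlgebra I G) (a : G) :
    VectorField.mlieBracket I (mulInvariantVectorField v) (mulInvariantVectorField w) a =
      mulInvariantVectorField ⁅v, w⁆ a := by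
  rw [GroupLieAlgebra.bracket_def, mulInvariantVector_mlieBracket]

/-- The bracket of a combination of left-invariant fields with a left-invariant field. -/
theorem mlieBracket_frameField {ι : Type*} [Fintype ι]
    (b : Module.Basis ι ℝ (GroupLieAlgebra I G)) {f : ι → G → ℝ}
    (hf : ∀ i, ContMDiff I 𝓘(ℝ, ℝ) ∞ (f i)) (w : GroupLieAlgebra I G) (a : G) :
    VectorField.mlieBracket I (frameField I b f) (mulInvariantVectorField w) a =
      ∑ i, (f i a • mulInvariantVectorField ⁅b i, w⁆ a -
        derivAlong I (mulInvariantVectorField w) (f i) a • mulInvariantVectorField (b i) a) := by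
  have hv : ∀ i, MDifferentiableAt I I.tangent
      (fun x => (mulInvariantVectorField (b i) x : TangentBundle I G)) a := fun i =>
    (contMDiff_infty_mulInvariantVectorField (I := I) (G := G) (b i)).mdifferentiable (by simp) a
  have hfd : ∀ i, MDifferentiableAt I 𝓘(ℝ, ℝ) (f i) a := fun i =>
    (hf i).mdifferentiable (by simp) a
  -- Differentiability of the partial sums is carried through the induction because additivity of
  -- the bracket requires it.
  have key : ∀ s : Finset ι, MDifferentiableAt I I.tangent
      (fun x => ((∑ i ∈ s, f i • mulInvariantVectorField (b i)) x : TangentBundle I G)) a ∧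
      VectorField.mlieBracket I (∑ i ∈ s, f i • mulInvariantVectorField (b i))
        (mulInvariantVectorField w) a =
      ∑ i ∈ s, (f i a • mulInvariantVectorField ⁅b i, w⁆ a -
        derivAlong I (mulInvariantVectorField w) (f i) a • mulInvariantVectorField (b i) a) := by
    classical
    intro s
    induction s using Finset.induction_on with
    | empty =>
      refine ⟨?_, ?_⟩
      · simp only [Finset.sum_empty]
        exact (contMDiff_zeroSection ℝ (TangentSpace I : G → Type _) (n := ∞)).mdifferentiable
          (by simp) a
      · rw [Finset.sum_empty, Finset.sum_empty, VectorField.mlieBracket_zero_left]; rfl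
    | insert i s hi ih =>
      have h1 : MDifferentiableAt I I.tangent
          (fun x => ((f i • mulInvariantVectorField (b i)) x : TangentBundle I G)) a :=
        (hfd i).smul_section (hv i)
      rw [Finset.sum_insert hi, Finset.sum_insert hi]
      refine ⟨mdifferentiableAt_add_section h1 ih.1, ?_⟩
      rw [VectorField.mlieBracket_add_left h1 ih.1, ih.2,
        VectorField.mlieBracket_smul_left (hfd i) (hv i), mlieBracket_mulInvariantVectorField]
      congr 1
      rw [sub_eq_add_neg, add_comm, neg_smul]
      rfl
  have h2 : frameField I b f = ∑ i, f i • mulInvariantVectorField (b i) := by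
    ext x
    simp [frameField]
  rw [h2, (key Finset.univ).2]

end
end

/-! ### The coadjoint and adjoint fields as initial velocities -/

noncomputable section

section
variable {E H G : Type*} [NormedAddCommGroup E] [NormedSpace ℝ E] [FiniteDimensional ℝ E]
  [TopologicalSpace H]
  {I : ModelWithCorners ℝ E H} [TopologicalSpace G] [ChartedSpace H G] [Group G] [LieGroup I ∞ G]

/-- The lift of a flow of `v^L` starts with velocity `(v^L, ad*_v)`. -/
theorem IsFlowOn.hasMFDerivAt_leftCoadField [I.Boundaryless] {v : GroupLieAlgebra I G}
    {D : Set (ℝ × G)} {φ : ℝ → G → G} (h : IsFlowOn I (mulInvariantVectorField v) D φ)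
    (x : G × (E →L[ℝ] ℝ)) :
    HasMFDerivAt 𝓘(ℝ, ℝ) (I.prod 𝓘(ℝ, E →L[ℝ] ℝ)) (fun t => (leftTrivialization G I).symm
      (cotangentMap I (φ t) (leftTrivialization G I x))) 0
      ((1 : ℝ →L[ℝ] ℝ).smulRight (leftCoadField I v x)) := by
  refine h.hasMFDerivAt_prodMk (h.hasDerivAt_leftFunctional (Module.finBasis ℝ E) x.1 x.2 _
    fun i => ?_) x
  rw [mlieBracket_mulInvariantVectorField, mfderiv_inv_mul_mulInvariantVectorField]
  rfl

variable {ι : Type*} [Fintype ι] (b : Module.Basis ι ℝ (GroupLieAlgebra I G))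

/-- The trivialization of the cotangent bundle given by a basis of the Lie algebra. -/
def basisTrivialization : Diffeomorph (I.prod 𝓘(ℝ, ι → ℝ)) (I.prod 𝓘(ℝ, E →L[ℝ] ℝ))
    (G × (ι → ℝ)) (CotangentBundle I G) ∞ where
  toFun x := leftCovector I (x.1, (Module.Basis.evalDual (E := E) b).symm x.2)
  invFun p := (p.1, Module.Basis.evalDual (E := E) b (leftFunctional p))
  left_inv x := Prod.ext rfl (by
    simp only [leftFunctional_leftCovector, ContinuousLinearEquiv.apply_symm_apply])
  right_inv p := by
    simp only [ContinuousLinearEquiv.symm_apply_apply, leftCovector_leftFunctional]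
  contMDiff_toFun := contMDiff_leftCovector.comp (contMDiff_fst.prodMk
    (((Module.Basis.evalDual (E := E) b).symm : (ι → ℝ) →L[ℝ] (E →L[ℝ] ℝ)).contMDiff.comp
      contMDiff_snd))
  contMDiff_invFun := (contMDiff_proj _).prodMk
    ((Module.Basis.evalDual (E := E) b : (E →L[ℝ] ℝ) →L[ℝ] (ι → ℝ)).contMDiff.comp
      contMDiff_leftFunctional)

theorem basisTrivialization_apply (x : G × (ι → ℝ)) :
    basisTrivialization b x = leftCovector I (x.1, dualCombination I b x.2) := by
  rw [← evalDual_symm_eq_dualCombination]; rfl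

omit [LieGroup I ∞ G] in
theorem dualCombination_bracket (β : ι → ℝ) (i j : ι) :
    dualCombination I b β (⁅b i, b j⁆ : GroupLieAlgebra I G) =
      ∑ k, structureConstant I b i j k * β k := by
  change (∑ k, β k • b.coord k : GroupLieAlgebra I G →ₗ[ℝ] ℝ) ⁅b i, b j⁆ = _
  simp [structureConstant, mul_comm]

/-- Translating the expanded bracket back to `1` replaces `v_i^L` by `v_i`, on which the covector is
`β i`, and `[v_i^L, v_j^L]` by `[v_i, v_j]`, which produces the structure constants. -/
theorem adjointRHS_eq {f : ι → G → ℝ} (hf : ∀ i, ContMDiff I 𝓘(ℝ, ℝ) ∞ (f i)) (a : G)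
    (β : ι → ℝ) (j : ι) : adjointRHS I b f a β j = dualCombination I b β
      ((mfderiv I I (fun y : G => a⁻¹ * y) a : TangentSpace I a → E)
        (VectorField.mlieBracket I (frameField I b f) (mulInvariantVectorField (b j)) a)) := by
  rw [mlieBracket_frameField b hf]
  obtain ⟨A, hA⟩ : ∃ A : E →L[ℝ] E, A = mfderiv I I (fun y : G => a⁻¹ * y) a := ⟨_, rfl⟩
  obtain ⟨L, hL⟩ : ∃ L : TangentSpace I a →ₗ[ℝ] ℝ, ∀ u, L u = dualCombination I b β
      ((mfderiv I I (fun y : G => a⁻¹ * y) a : TangentSpace I a → E) u) := by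
    rw [← hA]
    exact ⟨((dualCombination I b β).comp A : E →L[ℝ] ℝ).toLinearMap, fun _ => rfl⟩
  have hL' : ∀ w : GroupLieAlgebra I G, L (mulInvariantVectorField w a) =
      dualCombination I b β w := fun w => by
    rw [hL, mfderiv_inv_mul_mulInvariantVectorField]
  rw [← hL]
  simp only [map_sum, map_sub, map_smul, hL', dualCombination_bracket, dualCombination_apply,
    smul_eq_mul, Finset.sum_sub_distrib, adjointRHS, Finset.mul_sum, mul_assoc]

theorem IsFlowOn.hasMFDerivAt_adjointField [I.Boundaryless] {f : ι → G → ℝ}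
    (hf : ∀ i, ContMDiff I 𝓘(ℝ, ℝ) ∞ (f i))
    {D : Set (ℝ × G)} {φ : ℝ → G → G} (h : IsFlowOn I (frameField I b f) D φ)
    (x : G × (ι → ℝ)) :
    HasMFDerivAt 𝓘(ℝ, ℝ) (I.prod 𝓘(ℝ, ι → ℝ)) (fun t => (basisTrivialization b).symm
      (cotangentMap I (φ t) (basisTrivialization b x))) 0
      ((1 : ℝ →L[ℝ] ℝ).smulRight (adjointField I b f x)) := by
  have h1 := h.hasDerivAt_leftFunctional b x.1 (dualCombination I b x.2)
    (dualCombination I b (adjointRHS I b f x.1 x.2)) fun j => by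
      rw [dualCombination_apply, adjointRHS_eq b hf]
  have h2 := (Module.Basis.evalDual (E := E) b : _ →L[ℝ] (ι → ℝ)).hasFDerivAt.comp_hasDerivAt
    (0 : ℝ) h1
  have h3 := h.hasMFDerivAt_prodMk (h2.congr_deriv (g' := adjointRHS I b f x.1 x.2) (by
    ext j; exact dualCombination_apply b _ j)) x
  refine HasMFDerivAt.congr_of_eventuallyEq h3 (Filter.Eventually.of_forall fun t => ?_)
  have h4 := congrArg (fun p => (basisTrivialization b).symm (cotangentMap I (φ t) p))
    (basisTrivialization_apply b x)
  exact h4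

omit [FiniteDimensional ℝ E] in
theorem contMDiff_frameField {f : ι → G → ℝ} (hf : ∀ i, ContMDiff I 𝓘(ℝ, ℝ) ∞ (f i)) :
    ContMDiff I I.tangent ∞ (fun a => (⟨a, frameField I b f a⟩ : TangentBundle I G)) :=
  ContMDiff.sum_section (t := fun i a => f i a • mulInvariantVectorField (b i) a) fun i _ =>
    (hf i).smul_section (contMDiff_infty_mulInvariantVectorField (b i))

end
end

/-! ### Integral curves of left-invariant fields and the exponential map -/

noncomputable section

section
variable {E H M : Type*} [NormedAddCommGroup E] [NormedSpace ℝ E] [TopologicalSpace H]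
  {I : ModelWithCorners ℝ E H} [TopologicalSpace M] [ChartedSpace H M] [IsManifold I 1 M]

/-- Integral curves of a smooth vector field are smooth. -/
theorem IsMIntegralCurve.contMDiff {X : (q : M) → TangentSpace I q}
    (hX : ContMDiff I I.tangent ∞ (fun x => (⟨x, X x⟩ : TangentBundle I M)))
    {γ : ℝ → M} (h : IsMIntegralCurve γ X) : ContMDiff 𝓘(ℝ, ℝ) I ∞ γ := by
  intro t₀
  rw [contMDiffAt_infty]
  intro n
  -- Bootstrapping: if `γ` is `C^n`, its velocity `X ∘ γ` is `C^n` in a chart, so `γ` is `C^(n+1)`.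
  induction n with
  | zero => exact (contMDiff_zero_iff.2 h.continuous) t₀
  | succ n ih =>
    rw [contMDiffAt_iff_target]
    refine ⟨h.continuous.continuousAt, ?_⟩
    have hw : ContMDiffAt I 𝓘(ℝ, E) n
        (fun q => tangentCoordChange I q (γ t₀) q (X q)) (γ t₀) :=
      (contMDiffAt_totalSpace.1 (hX (γ t₀))).2.of_le (by exact_mod_cast le_top)
    have hu := (hw.comp t₀ ih).contDiffAt
    rw [contMDiffAt_iff_contDiffAt, Nat.cast_succ, contDiffAt_succ_iff_hasFDerivAt]
    refine ⟨fun t => (1 : ℝ →L[ℝ] ℝ).smulRight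
      (tangentCoordChange I (γ t) (γ t₀) (γ t) (X (γ t))), ?_, ?_⟩
    · exact ⟨_, (h.isMIntegralCurveAt t₀).eventually_hasDerivAt, fun t ht => ht.hasFDerivAt⟩
    · exact contDiffAt_const.smulRight hu

end

section
variable {E H G : Type*} [NormedAddCommGroup E] [NormedSpace ℝ E] [TopologicalSpace H]
  {I : ModelWithCorners ℝ E H} [TopologicalSpace G] [ChartedSpace H G] [Group G] [LieGroup I ∞ G]

theorem mfderiv_mul_left_mulInvariantVectorField (v : GroupLieAlgebra I G) (a g : G) :
    mfderiv I I (fun y : G => a * y) g (mulInvariantVectorField v g) =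
      mulInvariantVectorField v (a * g) := by
  have h1 : HasMFDerivAt I I (fun y : G => a * y) (g * 1)
      (mfderiv I I (fun y : G => a * y) g : TangentSpace I g →L[ℝ] _) := by
    rw [mul_one]; exact hasMFDerivAt_mul_left _ _
  have h2 := h1.comp (1 : G) (hasMFDerivAt_mul_left g 1)
  have h3 : (fun y : G => a * y) ∘ (fun y : G => g * y) = fun y => (a * g) * y := by
    ext; simp [mul_assoc]
  rw [h3] at h2
  exact (DFunLike.congr_fun (hasMFDerivAt_unique h2 (hasMFDerivAt_mul_left (a * g) 1)) v)

theorem mulInvariantVectorField_one (v : GroupLieAlgebra I G) :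
    mulInvariantVectorField v (1 : G) = v := by
  have h : HasMFDerivAt I I (fun y : G => 1 * y) 1 (ContinuousLinearMap.id ℝ E) :=
    (hasMFDerivAt_id (1 : G)).congr_of_eventuallyEq (Filter.Eventually.of_forall fun y => one_mul y)
  exact DFunLike.congr_fun (hasMFDerivAt_unique (hasMFDerivAt_mul_left (1 : G) 1) h) v

theorem HasMFDerivAt.mul_left_mulInvariantVectorField {v : GroupLieAlgebra I G} {γ : ℝ → G}
    {t : ℝ} (h : HasMFDerivAt 𝓘(ℝ, ℝ) I γ t
      ((1 : ℝ →L[ℝ] ℝ).smulRight (mulInvariantVectorField v (γ t)))) (a : G) :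
    HasMFDerivAt 𝓘(ℝ, ℝ) I (fun s => a * γ s) t
      ((1 : ℝ →L[ℝ] ℝ).smulRight (mulInvariantVectorField v (a * γ t))) := by
  have h1 := (hasMFDerivAt_mul_left (I := I) a (γ t)).comp t h
  refine h1.congr_mfderiv ?_
  rw [← mfderiv_mul_left_mulInvariantVectorField]
  exact ContinuousLinearMap.comp_one_smulRight (V := E) (W := E) _ _

variable [I.Boundaryless] [T2Space G]

/-- A local integral curve through `1`, defined for time `ε`, is left translated to every point with
the same `ε`. A uniform existence time forces completeness. -/
theorem exists_isMIntegralCurve_mulInvariantVectorField [CompleteSpace E]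
    (v : GroupLieAlgebra I G) : ∃ γ : ℝ → G, γ 0 = 1 ∧
      IsMIntegralCurve γ (mulInvariantVectorField v) := by
  have hX := (contMDiff_infty_mulInvariantVectorField (I := I) (G := G) v).of_le
    (show (1 : WithTop ℕ∞) ≤ ∞ by simp)
  have : IsManifold I 1 G := IsManifold.of_le (n := ∞) (by simp)
  obtain ⟨γ, h0, hγ⟩ := exists_isMIntegralCurveAt_of_contMDiffAt_boundaryless (I := I) 0 (hX 1)
  obtain ⟨ε, hε, hγ⟩ := isMIntegralCurveAt_iff'.1 hγ
  rw [Real.ball_eq_Ioo, zero_sub, zero_add] at hγ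
  refine exists_isMIntegralCurve_of_isMIntegralCurveOn hX hε (fun x => ⟨fun s => x * γ s,
    (congrArg (x * ·) h0).trans (mul_one x), fun t ht => ?_⟩) 1
  exact (((hγ t ht).hasMFDerivAt (Ioo_mem_nhds ht.1 ht.2)).mul_left_mulInvariantVectorField
    x).hasMFDerivWithinAt

/-- `t ↦ γ (t + s)` and `t ↦ γ s * γ t` are integral curves with the same initial point, so they
agree. -/
theorem IsMIntegralCurve.isOneParameterSubgroup {v : GroupLieAlgebra I G} {γ : ℝ → G}
    (h : IsMIntegralCurve γ (mulInvariantVectorField v)) (h0 : γ 0 = 1) :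
    IsOneParameterSubgroup I γ v := by
  have hX := contMDiff_infty_mulInvariantVectorField (I := I) (G := G) v
  have : IsManifold I 1 G := IsManifold.of_le (n := ∞) (by simp)
  refine ⟨fun s t => ?_, h.contMDiff hX, ?_⟩
  · have h1 := h.comp_add s
    have h2 : IsMIntegralCurve (fun t => γ s * γ t) (mulInvariantVectorField v) := fun t =>
      (h t).mul_left_mulInvariantVectorField (γ s)
    have h3 := isMIntegralCurve_Ioo_eq_of_contMDiff_boundaryless (t₀ := 0)
      (hX.of_le (by simp)) h1 h2 (by simp [h0])
    rw [add_comm]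
    exact congrFun h3 t
  · have h1 := h 0
    rw [h0, mulInvariantVectorField_one] at h1
    exact h1

omit [LieGroup I ∞ G] [I.Boundaryless] [T2Space G] in
theorem IsOneParameterSubgroup.map_zero {v : GroupLieAlgebra I G} {γ : ℝ → G}
    (h : IsOneParameterSubgroup I γ v) : γ 0 = 1 := by
  have := h.map_add 0 0
  rwa [add_zero, left_eq_mul] at this

omit [I.Boundaryless] [T2Space G] in
theorem IsOneParameterSubgroup.isMIntegralCurve {v : GroupLieAlgebra I G} {γ : ℝ → G}
    (h : IsOneParameterSubgroup I γ v) : IsMIntegralCurve γ (mulInvariantVectorField v) := by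
  intro t
  have h1 : HasMFDerivAt 𝓘(ℝ, ℝ) I γ (t - t)
      ((1 : ℝ →L[ℝ] ℝ).smulRight (mulInvariantVectorField v (γ (t - t)))) := by
    rw [sub_self, h.map_zero, mulInvariantVectorField_one]; exact h.hasMFDerivAt
  have h2 : HasMFDerivAt 𝓘(ℝ, ℝ) 𝓘(ℝ, ℝ) (fun s : ℝ => s - t) t (ContinuousLinearMap.id ℝ ℝ) :=
    ((hasFDerivAt_id (𝕜 := ℝ) t).sub_const t).hasMFDerivAt
  have h3 := HasMFDerivAt.comp (f := fun s : ℝ => s - t) t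
    (h1.mul_left_mulInvariantVectorField (γ t)) h2
  have h4 : (fun s => γ t * γ s) ∘ (fun s : ℝ => s - t) = γ := by
    ext s; rw [comp_apply, ← h.map_add, add_sub_cancel]
  rw [h4, sub_self, h.map_zero, mul_one] at h3
  exact h3

theorem IsOneParameterSubgroup.unique {v : GroupLieAlgebra I G} {γ γ' : ℝ → G}
    (h : IsOneParameterSubgroup I γ v) (h' : IsOneParameterSubgroup I γ' v) : γ = γ' := by
  have : IsManifold I 1 G := IsManifold.of_le (n := ∞) (by simp)
  exact isMIntegralCurve_Ioo_eq_of_contMDiff_boundaryless (t₀ := 0)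
    ((contMDiff_infty_mulInvariantVectorField (I := I) (G := G) v).of_le (by simp))
    h.isMIntegralCurve h'.isMIntegralCurve (by rw [h.map_zero, h'.map_zero])

/-- `s ↦ γ (s * t)` is a one-parameter subgroup with velocity `t • v`. Uniqueness identifies it with
the curve chosen by `Classical.epsilon`, and evaluation at `1` gives `γ t`. -/
theorem IsOneParameterSubgroup.lieExp_smul {v : GroupLieAlgebra I G} {γ : ℝ → G}
    (h : IsOneParameterSubgroup I γ v) (t : ℝ) : lieExp I (t • v) = γ t := by
  have h1 : IsOneParameterSubgroup I (fun s => γ (s * t)) (t • v) := by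
    refine ⟨fun r s => by rw [add_mul, h.map_add], h.contMDiff.comp
      (contMDiff_id.mul contMDiff_const), ?_⟩
    have h2 : ∀ s : ℝ, s = 0 → (mulInvariantVectorField v (γ s) : E) = v := by
      rintro _ rfl
      rw [h.map_zero, mulInvariantVectorField_one]
    exact (h.isMIntegralCurve.comp_mul t 0).congr_mfderiv
      (congrArg (fun u : E => (1 : ℝ →L[ℝ] ℝ).smulRight (t • u)) (h2 _ (zero_mul t)))
  have h2 := (Classical.epsilon_spec (p := fun γ => IsOneParameterSubgroup I γ (t • v))
    ⟨_, h1⟩).unique h1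
  exact (congrFun h2 1).trans (by simp)

theorem isOneParameterSubgroup_lieExp [CompleteSpace E] (v : GroupLieAlgebra I G) :
    IsOneParameterSubgroup I (fun t : ℝ => lieExp I (t • v)) v := by
  obtain ⟨γ, h0, hγ⟩ := exists_isMIntegralCurve_mulInvariantVectorField v
  have h := hγ.isOneParameterSubgroup h0
  have h1 : (fun t : ℝ => lieExp I (t • v)) = γ := funext h.lieExp_smul
  rwa [h1]

theorem isGlobalFlow_mul_lieExp [CompleteSpace E] (v : GroupLieAlgebra I G) :
    IsGlobalFlow I (mulInvariantVectorField v) (fun t a => a * lieExp I (t • v)) := by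
  have h := isOneParameterSubgroup_lieExp v
  refine ⟨isOpen_univ, fun _ => mem_univ _, fun _ => ordConnected_univ, ?_, fun q => ?_,
    fun t q _ => (h.isMIntegralCurve t).mul_left_mulInvariantVectorField q⟩
  · exact (contMDiff_snd.mul (h.contMDiff.comp contMDiff_fst)).contMDiffOn
  · rw [h.map_zero, mul_one]

end
end

/-! ### The adjoint action and the explicit lifted flow -/

noncomputable section

theorem HasMFDerivAt.hasDerivAt_of_smulRight {V : Type*} [NormedAddCommGroup V] [NormedSpace ℝ V]
    {g : ℝ → V} {g' : V} {t : ℝ}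
    (h : HasMFDerivAt 𝓘(ℝ, ℝ) 𝓘(ℝ, V) g t ((1 : ℝ →L[ℝ] ℝ).smulRight g')) : HasDerivAt g g' t := by
  have h1 : HasFDerivAt g ((1 : ℝ →L[ℝ] ℝ).smulRight g') t := h.hasFDerivAt
  simpa using h1.hasDerivAt

section
variable {E H G : Type*} [NormedAddCommGroup E] [NormedSpace ℝ E] [TopologicalSpace H]
  {I : ModelWithCorners ℝ E H} [TopologicalSpace G] [ChartedSpace H G] [Group G] [LieGroup I ∞ G]

theorem contMDiff_conj : ContMDiff (I.prod I) I ∞ (fun p : G × G => p.1 * p.2 * p.1⁻¹) :=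
  (contMDiff_fst.mul contMDiff_snd).mul ((contMDiff_inv I ∞).comp contMDiff_fst)

theorem hasMFDerivAt_conj (g : G) :
    HasMFDerivAt I I (fun x : G => g * x * g⁻¹) 1 (lieAd I g : E →L[ℝ] E) := by
  have h : ContMDiff I I ∞ (fun x : G => g * x * g⁻¹) :=
    contMDiff_conj.comp (contMDiff_const.prodMk contMDiff_id)
  exact (h.mdifferentiable (by simp) 1).hasMFDerivAt

/-- A partial differential of conjugation, smooth in `g` in tangent coordinates. Both its source and
target points equal `1`, so these coordinates are trivial. -/
theorem contMDiff_lieAd : ContMDiff (M := G) (M' := E →L[ℝ] E) I 𝓘(ℝ, E →L[ℝ] E) ∞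
    (lieAd I) := by
  intro g₀
  have h1 : ContMDiffAt I 𝓘(ℝ, E →L[ℝ] E) ∞ (inTangentCoordinates I I (fun _ : G => (1 : G))
      (fun g : G => g * 1 * g⁻¹) (fun g => mfderiv I I (fun x : G => g * x * g⁻¹) 1) g₀) g₀ :=
    ContMDiffAt.mfderiv (fun g x : G => g * x * g⁻¹) (fun _ => 1) contMDiff_conj.contMDiffAt
      contMDiffAt_const le_rfl
  refine h1.congr_of_eventuallyEq (Filter.Eventually.of_forall fun g => ?_)
  ext w
  obtain ⟨A, hA⟩ : ∃ A : E →L[ℝ] E, A = lieAd I g := ⟨_, rfl⟩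
  obtain ⟨u, hu⟩ : ∃ u : E, u =
      (trivializationAt E (TangentSpace I : G → Type _) 1).symmL ℝ 1 w := ⟨_, rfl⟩
  have hw : u = w := by
    have h2 := (trivializationAt E (TangentSpace I : G → Type _) 1).continuousLinearMapAt_symmL
      (R := ℝ) (mem_baseSet_trivializationAt E (TangentSpace I : G → Type _) 1) w
    rw [← h2]
    exact hu.trans (continuousLinearMapAt_trivializationAt_one rfl rfl _).symm
  have h3 := continuousLinearMapAt_trivializationAt_one (I := I) (G := G)
    (x := g₀ * 1 * g₀⁻¹) (y := g * 1 * g⁻¹) (by simp) (by simp) (A u)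
  refine Eq.trans ?_ (h3.symm.trans ?_)
  · rw [hA, hw]; rfl
  · rw [hA, hu]; rfl

/-- Differentiate `a * (g * x * g⁻¹) * g = (a * g) * x` at `x = 1`. -/
theorem mfderiv_mul_right_mulInvariantVectorField_lieAd (a g : G) (w : GroupLieAlgebra I G) :
    mfderiv I I (fun y : G => y * g) a (mulInvariantVectorField (lieAd I g w) a) =
      mulInvariantVectorField w (a * g) := by
  have h1 : HasMFDerivAt I I (fun y : G => y * g) (a * 1)
      (mfderiv I I (fun y : G => y * g) a : TangentSpace I a →L[ℝ] _) := by
    rw [mul_one]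
    exact ((contMDiff_mul_right (I := I) (n := ∞)).mdifferentiable (by simp) a).hasMFDerivAt
  have h2 := h1.comp (1 : G) (hasMFDerivAt_mul_left a 1)
  have h3 : HasMFDerivAt I I ((fun y : G => y * g) ∘ (fun y : G => a * y)) (g * 1 * g⁻¹)
      ((mfderiv I I (fun y : G => y * g) a : E →L[ℝ] E).comp
        (mfderiv I I (fun y : G => a * y) 1 : E →L[ℝ] E)) := by
    rw [mul_one, mul_inv_cancel]; exact h2
  have h4 := HasMFDerivAt.comp (f := fun x : G => g * x * g⁻¹) (1 : G) h3 (hasMFDerivAt_conj g)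
  have h5 : ((fun y : G => y * g) ∘ (fun y : G => a * y)) ∘ (fun x : G => g * x * g⁻¹) =
      fun x => (a * g) * x := by
    ext; simp [mul_assoc]
  rw [h5] at h4
  exact DFunLike.congr_fun (hasMFDerivAt_unique h4 (hasMFDerivAt_mul_left (a * g) 1)) w

/-- Test on `w^L`: pulling it back by `R_g` gives `(Ad_g w)^L`, so `ψ` becomes `ψ ∘ Ad_g`. -/
theorem cotangentMap_mul_right_leftCovector {g a : G}
    (hinv : (mfderiv I I (fun y : G => y * g) a).IsInvertible) (ψ : E →L[ℝ] ℝ) :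
    cotangentMap I (fun y => y * g) (leftCovector I (a, ψ)) =
      leftCovector I (a * g, lieCoAd I g ψ) := by
  rw [← leftCovector_leftFunctional (cotangentMap I (fun y => y * g) (leftCovector I (a, ψ)))]
  refine congrArg (fun χ : E →L[ℝ] ℝ => leftCovector I (a * g, χ))
    (ContinuousLinearMap.ext fun w : GroupLieAlgebra I G => ?_)
  have h1 : (mfderiv I I (fun y : G => y * g) a).inverse (mulInvariantVectorField w (a * g)) =
      mulInvariantVectorField (lieAd I g w) a := by
    rw [← mfderiv_mul_right_mulInvariantVectorField_lieAd, hinv.inverse_apply_self]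
  have h2 := mfderiv_inv_mul_mulInvariantVectorField (I := I) a (lieAd I g w)
  rw [← h1] at h2
  exact congrArg ψ h2

variable [FiniteDimensional ℝ E] [I.Boundaryless] [T2Space G]

theorem cotangentMap_mul_lieExp_leftCovector (v : GroupLieAlgebra I G) (t : ℝ) (a : G)
    (ψ : E →L[ℝ] ℝ) : cotangentMap I (fun y => y * lieExp I (t • v)) (leftCovector I (a, ψ)) =
      leftCovector I (a * lieExp I (t • v), lieCoAd I (lieExp I (t • v)) ψ) := by
  have : IsManifold I 1 G := IsManifold.of_le (n := ∞) (by simp)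
  have : CompleteSpace E := FiniteDimensional.complete ℝ E
  exact cotangentMap_mul_right_leftCovector (IsGlobalFlow.isInvertible_mfderiv
    (isGlobalFlow_mul_lieExp v)
    ((contMDiff_infty_mulInvariantVectorField v).of_le (by simp)) t a) ψ

/-- Smoothness is visible in the explicit formula. The velocity comes from recognising the formula
as the lifted flow and using its group law, so `Ad` is never differentiated along `exp`. -/
theorem isGlobalFlow_leftCoadField (v : GroupLieAlgebra I G) :
    IsGlobalFlow (I.prod 𝓘(ℝ, E →L[ℝ] ℝ)) (leftCoadField I v)
      (fun t (x : G × (E →L[ℝ] ℝ)) =>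
        (x.1 * lieExp I (t • v), lieCoAd I (lieExp I (t • v)) x.2)) := by
  have : IsManifold I 1 G := IsManifold.of_le (n := ∞) (by simp)
  have : CompleteSpace E := FiniteDimensional.complete ℝ E
  have hexp := isOneParameterSubgroup_lieExp v
  have hflow := isGlobalFlow_mul_lieExp v
  have hlift : ∀ (t : ℝ) (x : G × (E →L[ℝ] ℝ)),
      (x.1 * lieExp I (t • v), lieCoAd I (lieExp I (t • v)) x.2) = (leftTrivialization G I).symm
        (cotangentMap I (fun y => y * lieExp I (t • v)) (leftTrivialization G I x)) := by
    rintro t ⟨a, ψ⟩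
    rw [leftTrivialization_apply, cotangentMap_mul_lieExp_leftCovector, ← leftTrivialization_apply,
      Diffeomorph.symm_apply_apply]
  refine ⟨isOpen_univ, fun _ => mem_univ _, fun _ => ordConnected_univ, ?_, fun x => ?_,
    fun t x _ => ?_⟩
  · have h1 : ContMDiff (𝓘(ℝ, ℝ).prod (I.prod 𝓘(ℝ, E →L[ℝ] ℝ))) I ∞
        (fun p : ℝ × G × (E →L[ℝ] ℝ) => lieExp I (p.1 • v)) :=
      hexp.contMDiff.comp contMDiff_fst
    have h2 : ContMDiff (M' := E →L[ℝ] E) (𝓘(ℝ, ℝ).prod (I.prod 𝓘(ℝ, E →L[ℝ] ℝ)))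
        𝓘(ℝ, E →L[ℝ] E) ∞ (fun p : ℝ × G × (E →L[ℝ] ℝ) => lieAd I (lieExp I (p.1 • v))) :=
      contMDiff_lieAd.comp h1
    have h3 : ContMDiff (𝓘(ℝ, ℝ).prod (I.prod 𝓘(ℝ, E →L[ℝ] ℝ))) 𝓘(ℝ, E →L[ℝ] ℝ) ∞
        (fun p : ℝ × G × (E →L[ℝ] ℝ) => p.2.2) := contMDiff_snd.comp contMDiff_snd
    exact (((contMDiff_fst.comp contMDiff_snd).mul h1).prodMk (h3.clm_comp h2)).contMDiffOn
  · rw [hlift, cotangentMap_of_forall_eq hflow.map_zero, Diffeomorph.symm_apply_apply]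
  · have key : ∀ F : ℝ → G × (E →L[ℝ] ℝ), (F = fun t => (leftTrivialization G I).symm
        (cotangentMap I (fun y => y * lieExp I (t • v)) (leftTrivialization G I x))) →
        HasMFDerivAt 𝓘(ℝ, ℝ) (I.prod 𝓘(ℝ, E →L[ℝ] ℝ)) F t
          ((1 : ℝ →L[ℝ] ℝ).smulRight (leftCoadField I v (F t))) := by
      rintro _ rfl
      exact IsGlobalFlow.hasMFDerivAt_symm_cotangentMap (leftTrivialization G I) hflow
        ((contMDiff_infty_mulInvariantVectorField v).of_le (by simp))
        (fun x => hflow.hasMFDerivAt_leftCoadField x) t x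
    exact key _ (funext fun t => hlift t x)

end

/-! ### The adjoint equation along a global flow -/

section
variable {E H G : Type*} [NormedAddCommGroup E] [NormedSpace ℝ E] [FiniteDimensional ℝ E]
  [TopologicalSpace H] {I : ModelWithCorners ℝ E H} [I.Boundaryless] [TopologicalSpace G]
  [T2Space G] [ChartedSpace H G] [Group G] [LieGroup I ∞ G]

/-- `β` is the fibre component of the lifted flow in the basis trivialization; the equation is the
fibre component of its velocity. -/
theorem IsGlobalFlow.exists_adjoint {ι : Type*} [Fintype ι]
    (b : Module.Basis ι ℝ (GroupLieAlgebra I G)) {f : ι → G → ℝ}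
    (hf : ∀ i, ContMDiff I 𝓘(ℝ, ℝ) ∞ (f i)) {φ : ℝ → G → G}
    (h : IsGlobalFlow I (frameField I b f) φ) (a : G) (β₀ : ι → ℝ) :
    ∃ β : ℝ → ι → ℝ, β 0 = β₀ ∧
      (∀ t, cotangentMap I (φ t) (basisTrivialization b (a, β₀)) =
        basisTrivialization b (φ t a, β t)) ∧
      ∀ t j, HasDerivAt (fun s => β s j) (adjointRHS I b f (φ t a) (β t) j) t := by
  have : IsManifold I 1 G := IsManifold.of_le (n := ∞) (by simp)
  refine ⟨fun t => ((basisTrivialization b).symm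
    (cotangentMap I (φ t) (basisTrivialization b (a, β₀)))).2, ?_, fun t => ?_, fun t => ?_⟩
  · simp only [cotangentMap_of_forall_eq h.map_zero, Diffeomorph.symm_apply_apply]
  · exact ((basisTrivialization b).apply_symm_apply _).symm
  · have h1 := IsGlobalFlow.hasMFDerivAt_symm_cotangentMap (basisTrivialization b) h
      ((contMDiff_frameField b hf).of_le (by simp))
      (fun x => h.hasMFDerivAt_adjointField b hf x) t (a, β₀)
    have h2 : HasMFDerivAt 𝓘(ℝ, ℝ) 𝓘(ℝ, ι → ℝ) (fun s => ((basisTrivialization b).symm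
        (cotangentMap I (φ s) (basisTrivialization b (a, β₀)))).2) t
        ((1 : ℝ →L[ℝ] ℝ).smulRight (adjointRHS I b f (φ t a) ((basisTrivialization b).symm
          (cotangentMap I (φ t) (basisTrivialization b (a, β₀)))).2)) :=
      ((hasMFDerivAt_snd _).comp t h1).congr_mfderiv
        (ContinuousLinearMap.comp_one_smulRight (V := E × (ι → ℝ)) (W := ι → ℝ)
          (ContinuousLinearMap.snd ℝ E (ι → ℝ)) _)
    exact hasDerivAt_pi.1 h2.hasDerivAt_of_smulRight

end
end

theorem mainTheorem9 {E H G : Type*} [NormedAddCommGroup E] [NormedSpace ℝ E]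
    [FiniteDimensional ℝ E] [TopologicalSpace H] (I : ModelWithCorners ℝ E H) [I.Boundaryless]
    [TopologicalSpace G] [T2Space G] [ChartedSpace H G] [Group G] [LieGroup I ∞ G] :
    -- part 1: left-invariant fields, in the left trivialization `Θ : G × 𝔤* ≃ T*G`
    (∃ Θ : Diffeomorph (I.prod 𝓘(ℝ, E →L[ℝ] ℝ)) (I.prod 𝓘(ℝ, E →L[ℝ] ℝ))
        (G × (E →L[ℝ] ℝ)) (CotangentBundle I G) ∞,
      (∀ x, Θ x = leftCovector I x) ∧
      ∀ v : GroupLieAlgebra I G,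
        IsGlobalFlow I (mulInvariantVectorField v) (fun t a => a * lieExp I (t • v)) ∧
        (∀ Y : (p : CotangentBundle I G) → TangentSpace (I.prod 𝓘(ℝ, E →L[ℝ] ℝ)) p,
          IsCotangentLift I (mulInvariantVectorField v) Y ↔
            VectorField.mpullback (I.prod 𝓘(ℝ, E →L[ℝ] ℝ)) (I.prod 𝓘(ℝ, E →L[ℝ] ℝ)) Θ Y =
              leftCoadField I v) ∧
        (∀ (t : ℝ) (a : G) (ψ : E →L[ℝ] ℝ),
          cotangentMap I (fun y => y * lieExp I (t • v)) (Θ (a, ψ)) =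
            Θ (a * lieExp I (t • v), lieCoAd I (lieExp I (t • v)) ψ)) ∧
        IsGlobalFlow (I.prod 𝓘(ℝ, E →L[ℝ] ℝ)) (leftCoadField I v)
          (fun t (x : G × (E →L[ℝ] ℝ)) =>
            (x.1 * lieExp I (t • v), lieCoAd I (lieExp I (t • v)) x.2))) ∧
    -- part 2: the adjoint equation, in the trivialization given by a basis of the Lie algebra
    (∀ {ι : Type*} [Fintype ι] (b : Module.Basis ι ℝ (GroupLieAlgebra I G)),
      ∃ Ψ : Diffeomorph (I.prod 𝓘(ℝ, ι → ℝ)) (I.prod 𝓘(ℝ, E →L[ℝ] ℝ))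
          (G × (ι → ℝ)) (CotangentBundle I G) ∞,
        (∀ a β, Ψ (a, β) = leftCovector I (a, dualCombination I b β)) ∧
        ∀ f : ι → G → ℝ, (∀ i, ContMDiff I 𝓘(ℝ, ℝ) ∞ (f i)) →
          (∀ (D : Set (ℝ × G)) (φ : ℝ → G → G), IsFlowOn I (frameField I b f) D φ →
            ∀ Y : (p : CotangentBundle I G) → TangentSpace (I.prod 𝓘(ℝ, E →L[ℝ] ℝ)) p,
              IsCotangentLift I (frameField I b f) Y ↔
                VectorField.mpullback (I.prod 𝓘(ℝ, ι → ℝ)) (I.prod 𝓘(ℝ, E →L[ℝ] ℝ)) Ψ Y =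
                  adjointField I b f) ∧
          (∀ φ : ℝ → G → G, IsGlobalFlow I (frameField I b f) φ → ∀ (a : G) (β₀ : ι → ℝ),
            ∃ β : ℝ → ι → ℝ, β 0 = β₀ ∧
              (∀ t, cotangentMap I (φ t) (Ψ (a, β₀)) = Ψ (φ t a, β t)) ∧
              ∀ t j, HasDerivAt (fun s => β s j) (adjointRHS I b f (φ t a) (β t) j) t)) := by
  have : CompleteSpace E := FiniteDimensional.complete ℝ E
  have : IsManifold I 1 G := IsManifold.of_le (n := ∞) (by simp)
  refine ⟨⟨leftTrivialization G I, leftTrivialization_apply, fun v =>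
    ⟨isGlobalFlow_mul_lieExp v, fun Y => ?_, cotangentMap_mul_lieExp_leftCovector v,
      isGlobalFlow_leftCoadField v⟩⟩, fun {ι} _ b => ⟨basisTrivialization b,
    fun a β => basisTrivialization_apply b (a, β), fun f hf => ⟨fun D φ h Y => ?_,
      fun φ h a β₀ => IsGlobalFlow.exists_adjoint b hf h a β₀⟩⟩⟩
  · exact isCotangentLift_iff_mpullback_eq (leftTrivialization G I)
      (fun D φ h x => h.hasMFDerivAt_leftCoadField x) ⟨univ, _, isGlobalFlow_mul_lieExp v⟩ Y
  · exact isCotangentLift_iff_mpullback_eq (basisTrivialization b)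
      (fun D φ h x => h.hasMFDerivAt_adjointField b hf x) ⟨D, φ, h⟩ Y
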